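/- Let $\mathbb{K}\in\{\mathbb{R},\mathbb{C}\}$, let $K$ be a nonempty compact Hausdorff space, and let $X$ be a Banach space over $\mathbb{K}$ that is locally uniformly rotund (LUR): $\|x_k-x\|\to 0$ whenever $\lim_k\|\tfrac12(x_k+x)\|=\lim_k\|x_k\|=\|x\|$. A uniform algebra over $K$ is a closed subalgebra of $C(K)=C(K,\mathbb{K})$ that contains the constants and separates the points of $K$. Let $A(K,X)$ be a closed subspace of $C(K,X)$ (with the supremum norm) such that (i) the base algebra $A:=\{x^*\circ f: x^*\in X^*,\ f\in A(K,X)\}$ is a uniform algebra over $K$; (ii) $A\otimes X\subset A(K,X)$; (iii) $f\cdot g\in A(K,X)$ for all $f\in A$, $g\in A(K,X)$. Let $\Gamma$ be the Shilov boundary of $A$, i.e. the smallest closed set $S\subset K$ such that every $f\in A$ satisfies $|f(t)|=\|f\|_\infty$ for some $t\in S$. For a Banach space $Y$ with closed unit ball $B_Y$ and unit sphere $S_Y$, a slice of $B_Y$ is a set $\{y\in B_Y:\operatorname{Re}y^*(y)>\sup_{B_Y}\operatorname{Re}y^*-\varepsilon\}$ with $y^*\in S_{Y^*}$ and $\varepsilon>0$.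 A convex combination of slices of $B_Y$ is a set $\sum_{i=1}^n\lambda_iS_i$ with $n\in\mathbb{N}$, $\lambda_i>0$, $\sum_{i=1}^n\lambda_i=1$, and $S_1,\dots,S_n$ slices of $B_Y$. The space $Y$ has - the polynomial Daugavet property if $\|\mathrm{Id}+P\|=1+\|P\|$ for every weakly compact continuous polynomial $P:Y\to Y$, where a continuous polynomial is a finite sum of continuous homogeneous polynomials (constants included), $\|P\|=\sup_{y\in B_Y}\|P(y)\|$, and $P$ is weakly compact if $P(B_Y)$ is relatively weakly compact; - the restricted DSD2P if $\sup_{y\in C}\|x-y\|=2$ for every convex combination $C$ of slices of $B_Y$ and every $x\in C\cap S_Y$; - the DD2P if $\sup_{y\in W}\|x-y\|=2$ for every nonempty relatively weakly open subset $W$ of $B_Y$ and every $x\in W\cap S_Y$; - the DLD2P if $\sup_{y\in S}\|x-y\|=2$ for every slice $S$ of $B_Y$ and every $x\in S\cap S_Y$; - property $(D)$ if $\|I-P\|=2$ for every rank-one, norm-one projection $P:Y\to Y$. Then the following statements are equivalent: 1. $\Gamma$ has no isolated points. 2. $A(K,X)$ has the polynomial Daugavet property. 3. $A(K,X)$ has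 the restricted DSD2P. 4. $A(K,X)$ has the DD2P. 5. $A(K,X)$ has the DLD2P. 6. $A(K,X)$ has property $(D)$. -/

import Mathlib

open Set Filter Topology

noncomputable section

section BanachGeometry

variable (𝕜 : Type*) [RCLike 𝕜] (Y : Type*) [NormedAddCommGroup Y] [NormedSpace 𝕜 Y]

/-- Local uniform rotundity (LUR). -/
def IsLUR : Prop :=
  ∀ (x : Y) (u : ℕ → Y),
    Tendsto (fun k => ‖(2⁻¹ : 𝕜) • (u k + x)‖) atTop (𝓝 ‖x‖) →
    Tendsto (fun k => ‖u k‖) atTop (𝓝 ‖x‖) →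
    Tendsto (fun k => ‖u k - x‖) atTop (𝓝 0)

variable {Y}

/-- The slice `S(A, φ, ε) = {x ∈ A : Re φ(x) > sup_{y ∈ A} Re φ(y) - ε}`. -/
def slice (A : Set Y) (φ : StrongDual 𝕜 Y) (ε : ℝ) : Set Y :=
  {x ∈ A | sSup ((fun y => RCLike.re (φ y)) '' A) - ε < RCLike.re (φ x)}

/-- `S` is a slice of the (bounded) set `A`. -/
def IsSlice (A S : Set Y) : Prop :=
  ∃ φ : StrongDual 𝕜 Y, ‖φ‖ = 1 ∧ ∃ ε : ℝ, 0 < ε ∧ S = slice 𝕜 A φ ε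

/-- `C` is a convex combination of slices of `A`. -/
def IsConvexCombOfSlices (A C : Set Y) : Prop :=
  ∃ (n : ℕ) (c : Fin n → ℝ) (S : Fin n → Set Y),
    (∀ i, 0 < c i) ∧ ∑ i, c i = 1 ∧ (∀ i, IsSlice 𝕜 A (S i)) ∧
    C = {x ∈ A | ∃ y : Fin n → Y, (∀ i, y i ∈ S i) ∧ x = ∑ i, (c i : 𝕜) • y i}

/-- `W` is a relatively weakly open subset of `A`. -/
def IsRelWeaklyOpen (A W : Set Y) : Prop :=
  ∃ U : Set (WeakSpace 𝕜 Y), IsOpen U ∧ W = A ∩ toWeakSpace 𝕜 Y ⁻¹' U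

variable (Y)

/-- The restricted diametral strong diameter two property. -/
def HasRestrictedDSD2P : Prop :=
  ∀ C : Set Y, IsConvexCombOfSlices 𝕜 (Metric.closedBall (0 : Y) 1) C →
    ∀ x ∈ C ∩ Metric.sphere (0 : Y) 1, IsLUB ((fun y => ‖x - y‖) '' C) 2

/-- The diametral diameter two property. -/
def HasDD2P : Prop :=
  ∀ W : Set Y, W.Nonempty → IsRelWeaklyOpen 𝕜 (Metric.closedBall (0 : Y) 1) W →
    ∀ x ∈ W ∩ Metric.sphere (0 : Y) 1, IsLUB ((fun y => ‖x - y‖) '' W) 2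

/-- The diametral local diameter two property. -/
def HasDLD2P : Prop :=
  ∀ S : Set Y, IsSlice 𝕜 (Metric.closedBall (0 : Y) 1) S →
    ∀ x ∈ S ∩ Metric.sphere (0 : Y) 1, IsLUB ((fun y => ‖x - y‖) '' S) 2

/-- Property `(D)`: `‖I - P‖ = 2` for every rank-one, norm-one projection `P`. -/
def HasPropertyD : Prop :=
  ∀ P : Y →L[𝕜] Y, IsIdempotentElem P →
    Module.finrank 𝕜 (LinearMap.range (P : Y →ₗ[𝕜] Y)) = 1 → ‖P‖ = 1 →
    ‖ContinuousLinearMap.id 𝕜 Y - P‖ = 2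

variable {Y}

/-- `P` is a continuous polynomial: a finite sum of continuous homogeneous polynomials, i.e. of
restrictions to the diagonal of continuous `k`-linear maps (`k = 0` gives the constants). -/
def IsContinuousPolynomial (P : Y → Y) : Prop :=
  ∃ (p : FormalMultilinearSeries 𝕜 Y Y) (n : ℕ),
    ∀ x, P x = ∑ k ∈ Finset.range n, p k (fun _ => x)

/-- The norm `‖P‖ = sup_{‖x‖ ≤ 1} ‖P x‖` of a polynomial. -/
def polyNorm (P : Y → Y) : ℝ :=
  ⨆ x : Metric.closedBall (0 : Y) 1, ‖P x‖

/-- The supremum defining `polyNorm` is finite for continuous polynomials. -/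
theorem IsContinuousPolynomial.bddAbove {P : Y → Y} (hP : IsContinuousPolynomial 𝕜 P) :
    BddAbove (range fun x : Metric.closedBall (0 : Y) 1 => ‖P x‖) := by
  obtain ⟨p, n, h⟩ := hP
  refine ⟨∑ k ∈ Finset.range n, ‖p k‖, ?_⟩
  rintro _ ⟨⟨x, hx⟩, rfl⟩
  have hx1 : ‖x‖ ≤ 1 := by simpa using hx
  simp only [h]
  refine (norm_sum_le _ _).trans (Finset.sum_le_sum fun k _ => ?_)
  refine ((p k).le_opNorm _).trans ?_
  refine mul_le_of_le_one_right (norm_nonneg _) ?_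
  exact Finset.prod_le_one (fun _ _ => norm_nonneg _) (fun _ _ => hx1)

/-- `P` maps the closed unit ball to a relatively weakly compact set. -/
def IsWeaklyCompactMap (P : Y → Y) : Prop :=
  IsCompact (closure (toWeakSpace 𝕜 Y '' (P '' Metric.closedBall (0 : Y) 1)))

variable (Y)

/-- The polynomial Daugavet property: `‖Id + P‖ = 1 + ‖P‖` for every weakly compact polynomial
`P`. -/
def HasPolynomialDaugavet : Prop :=
  ∀ P : Y → Y, IsContinuousPolynomial 𝕜 P → IsWeaklyCompactMap 𝕜 P →
    polyNorm (fun x => x + P x) = 1 + polyNorm P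

end BanachGeometry

section FunctionSpaces

variable {𝕜 : Type*} [RCLike 𝕜] {K : Type*} [TopologicalSpace K] [CompactSpace K]
  {X : Type*} [NormedAddCommGroup X] [NormedSpace 𝕜 X]

/-- `A` is a uniform algebra over `K`: a closed subalgebra of `C(K, 𝕜)` which contains the
constants (part of being a `Subalgebra`) and separates the points of `K`. -/
def IsUniformAlgebra (A : Set C(K, 𝕜)) : Prop :=
  ∃ B : Subalgebra 𝕜 C(K, 𝕜), (B : Set C(K, 𝕜)) = A ∧ IsClosed A ∧ B.SeparatesPoints

/-- The base algebra `{φ ∘ f : φ ∈ X*, f ∈ E}` of `E ⊆ C(K, X)`. -/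
def baseAlgebra (E : Submodule 𝕜 C(K, X)) : Set C(K, 𝕜) :=
  {a | ∃ φ : StrongDual 𝕜 X, ∃ f ∈ E, ∀ t, a t = φ (f t)}

/-- `E` is an `A(K, X)` space. -/
structure IsAKXSpace (E : Submodule 𝕜 C(K, X)) : Prop where
  isClosed : IsClosed (E : Set C(K, X))
  base_isUniformAlgebra : IsUniformAlgebra (baseAlgebra E)
  /-- `A ⊗ X ⊆ E`; as `E` is a subspace, elementary tensors suffice. -/
  tensor_mem : ∀ a ∈ baseAlgebra E, ∀ x : X, a • ContinuousMap.const K x ∈ E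
  mul_mem : ∀ a ∈ baseAlgebra E, ∀ g ∈ E, a • g ∈ E

/-- `S` is a boundary for `A`: every function of `A` attains its norm on `S`. -/
def IsBoundary (A : Set C(K, 𝕜)) (S : Set K) : Prop :=
  ∀ f ∈ A, ∃ t ∈ S, ‖f t‖ = ‖f‖

/-- The Shilov boundary of `A`, the smallest closed boundary, as the intersection of all closed
boundaries. -/
def shilovBoundary (A : Set C(K, 𝕜)) : Set K :=
  sInf {S : Set K | IsClosed S ∧ IsBoundary A S}

theorem shilovBoundary_eq_of_isLeast {A : Set C(K, 𝕜)} {Γ : Set K}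
    (h : IsLeast {S : Set K | IsClosed S ∧ IsBoundary A S} Γ) : shilovBoundary A = Γ :=
  h.isGLB.sInf_eq

end FunctionSpaces

end

/-! ### The Shilov boundary, peak functions and a Urysohn lemma -/

section ShilovBoundary

variable {𝕜 : Type*} [RCLike 𝕜] {K : Type*} [TopologicalSpace K] [CompactSpace K]

/-! Write Γ for the Shilov boundary of the base algebra A. Composing with functionals shows that Γ
norms E as well as A.

Suppose Γ has no isolated points. Every neighbourhood of a point of Γ then carries functions h_n in
A, almost disjoint on Γ, with h_n close to 1 at some τ_n and |h_n| + |1 - h_n| ≤ 1 + δ_n on Γ, where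
δ_n → 0 (`IsAKXSpace.exists_isBumpSequence`). The affine map g ↦ h_n a + (1 - h_n) g pushes the
value at τ_n to a while almost preserving a ball that contains both a and g. The increments have
uniformly bounded finite sums, and scalar polynomials, in particular functionals, are continuous
along such increments (`IsFrechetPolynomial.tendsto`). With a = -x(t₀), where ‖x(t₀)‖ = ‖x‖ = 1,
this yields points weakly close to x and almost at distance 2 from it, hence the diametral
properties. For the Daugavet property, a Grothendieck double-limit argument uses weak compactness of
P to find g and a single point t with g(t) close to a prescribed value and (P g)(t) close to (P
f)(t₀), both tested against a given functional (`IsAKXSpace.exists_polynomial_near`).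

Each of the properties implies (D). If Γ had an isolated point t₀, some e in A would restrict to its
indicator on Γ. The projection g ↦ φ(g(t₀)) e x changes g only at t₀ as far as Γ can see, and there
LUR keeps ‖u - φ(u) x‖ uniformly below 2‖u‖ (`IsLUR.exists_norm_sub_smul_le`), so ‖I - P‖ < 2. -/

theorem ContinuousMap.exists_norm_apply_eq_norm [Nonempty K] {Y : Type*} [NormedAddCommGroup Y]
    (f : C(K, Y)) : ∃ t, ‖f t‖ = ‖f‖ := by
  obtain ⟨t, -, ht⟩ := isCompact_univ.exists_isMaxOn (f := fun t => ‖f t‖) univ_nonempty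
    (by fun_prop)
  exact ⟨t, le_antisymm (f.norm_coe_le_norm t)
    ((ContinuousMap.norm_le_of_nonempty f).2 fun s => ht (mem_univ s))⟩

theorem IsCompact.exists_norm_le_lt_one {K : Type*} [TopologicalSpace K] {S : Set K}
    (hS : IsCompact S) (f : C(K, 𝕜)) (h : ∀ t ∈ S, ‖f t‖ < 1) :
    ∃ r, 0 ≤ r ∧ r < 1 ∧ ∀ t ∈ S, ‖f t‖ ≤ r := by
  rcases S.eq_empty_or_nonempty with rfl | hne
  · exact ⟨0, le_rfl, one_pos, by simp⟩
  · obtain ⟨t, htS, ht⟩ := hS.exists_isMaxOn (f := fun t => ‖f t‖) hne (by fun_prop)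
    exact ⟨‖f t‖, norm_nonneg _, h t htS, fun s hs => ht hs⟩

variable (B : Subalgebra 𝕜 C(K, 𝕜))

/-- A closed set which is not a boundary is strictly dominated by some normalized function. -/
theorem exists_norm_le_of_not_isBoundary [Nonempty K] {S : Set K} (hS : IsClosed S)
    (h : ¬ IsBoundary (B : Set C(K, 𝕜)) S) :
    ∃ f ∈ B, ‖f‖ = 1 ∧ ∃ r, 0 ≤ r ∧ r < 1 ∧ ∀ t ∈ S, ‖f t‖ ≤ r := by
  simp only [IsBoundary, not_forall, not_exists, not_and] at h
  obtain ⟨f, hf, hne⟩ := h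
  by_cases h0 : f = 0
  · refine ⟨1, one_mem B, norm_one, 0, le_rfl, one_pos, fun t ht => ?_⟩
    exact absurd (by simp [h0]) (hne t ht)
  · have hpos : 0 < ‖f‖ := norm_pos_iff.2 h0
    have hnorm : ‖((‖f‖⁻¹ : ℝ) : 𝕜)‖ = ‖f‖⁻¹ := by
      rw [RCLike.norm_ofReal, abs_of_pos (inv_pos.2 hpos)]
    refine ⟨((‖f‖⁻¹ : ℝ) : 𝕜) • f, B.smul_mem hf _, ?_, ?_⟩
    · rw [norm_smul, hnorm, inv_mul_cancel₀ hpos.ne']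
    · refine hS.isCompact.exists_norm_le_lt_one _ fun t ht => ?_
      rw [ContinuousMap.smul_apply, norm_smul, hnorm, inv_mul_lt_iff₀ hpos, mul_one]
      exact lt_of_le_of_ne (f.norm_coe_le_norm t) (hne t ht)

/-- If removing V = {|φ| < 1 for all φ in s} destroyed the boundary property, some f of norm 1 would
satisfy |f| ≤ r < 1 on the rest of F. Choose φ in s with |φ| ≥ 1 at a point of G where |f| = 1. For
large m, f ^ m * φ is below 1 in modulus on F, yet at least 1 at that point. -/
theorem IsBoundary.diff_of_disjoint [Nonempty K] {F G : Set K} {s : Set C(K, 𝕜)}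
    (hs : s ⊆ B) (hsfin : s.Finite) (hF : IsClosed F) (hFB : IsBoundary (B : Set C(K, 𝕜)) F)
    (hGB : IsBoundary (B : Set C(K, 𝕜)) G)
    (hdis : ∀ t ∈ G, ∃ φ ∈ s, 1 ≤ ‖φ t‖) :
    IsClosed (F \ {t | ∀ φ ∈ s, ‖φ t‖ < 1}) ∧
      IsBoundary (B : Set C(K, 𝕜)) (F \ {t | ∀ φ ∈ s, ‖φ t‖ < 1}) := by
  have hopen : IsOpen {t | ∀ φ ∈ s, ‖φ t‖ < 1} := by
    have : {t | ∀ φ ∈ s, ‖φ t‖ < 1} = ⋂ φ ∈ s, {t | ‖φ t‖ < 1} := by ext; simp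
    rw [this]
    exact hsfin.isOpen_biInter fun φ _ => isOpen_lt (by fun_prop) continuous_const
  have hcl := hF.sdiff hopen
  refine ⟨hcl, ?_⟩
  by_contra hnot
  obtain ⟨f, hfB, hf1, r, hr0, hr1, hr⟩ := exists_norm_le_of_not_isBoundary B hcl hnot
  obtain ⟨t, htG, ht⟩ := hGB f hfB
  obtain ⟨φ, hφ, hφt⟩ := hdis t htG
  obtain ⟨m, hm⟩ : ∃ m : ℕ, r ^ m * ‖φ‖ < 1 := by
    have : Tendsto (fun m : ℕ => r ^ m * ‖φ‖) atTop (𝓝 (0 * ‖φ‖)) :=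
      (tendsto_pow_atTop_nhds_zero_of_lt_one hr0 hr1).mul_const _
    rw [zero_mul] at this
    exact (this.eventually (gt_mem_nhds one_pos)).exists
  obtain ⟨t', ht'F, ht'⟩ := hFB (f ^ m * φ) (B.mul_mem (pow_mem hfB m) (hs hφ))
  have hval : ∀ u, ‖(f ^ m * φ) u‖ = ‖f u‖ ^ m * ‖φ u‖ := fun u => by simp
  have hlt : ‖(f ^ m * φ) t'‖ < 1 := by
    rw [hval]
    by_cases hV : t' ∈ {t | ∀ φ ∈ s, ‖φ t‖ < 1}
    · have h1 : ‖f t'‖ ≤ 1 := hf1 ▸ f.norm_coe_le_norm t'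
      calc ‖f t'‖ ^ m * ‖φ t'‖ ≤ 1 * ‖φ t'‖ := by
            gcongr; exact pow_le_one₀ (norm_nonneg _) h1
        _ < 1 := by rw [one_mul]; exact hV φ hφ
    · have h1 := hr t' ⟨ht'F, hV⟩
      calc ‖f t'‖ ^ m * ‖φ t'‖ ≤ r ^ m * ‖φ‖ := by
            gcongr; exact φ.norm_coe_le_norm t'
        _ < 1 := hm
  have h2 : ‖(f ^ m * φ) t‖ < 1 := ((f ^ m * φ).norm_coe_le_norm t).trans_lt (ht' ▸ hlt)
  rw [hval, ht, hf1, one_pow, one_mul] at h2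
  exact absurd h2 (not_lt.2 hφt)

theorem exists_finite_separating (hsep : B.SeparatesPoints) {F : Set K} (hF : IsClosed F) {t : K}
    (ht : t ∉ F) : ∃ s ⊆ (B : Set C(K, 𝕜)), s.Finite ∧ (∀ φ ∈ s, φ t = 0) ∧
      ∀ u ∈ F, ∃ φ ∈ s, 1 ≤ ‖φ u‖ := by
  refine hF.isCompact.induction_on (p := fun F => ∃ s ⊆ (B : Set C(K, 𝕜)), s.Finite ∧
    (∀ φ ∈ s, φ t = 0) ∧ ∀ u ∈ F, ∃ φ ∈ s, 1 ≤ ‖φ u‖) ⟨∅, by simp⟩ ?_ ?_ ?_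
  · rintro F₁ F₂ hsub ⟨s, h1, h2, h3, h4⟩
    exact ⟨s, h1, h2, h3, fun u hu => h4 u (hsub hu)⟩
  · rintro F₁ F₂ ⟨s, h1, h2, h3, h4⟩ ⟨s', h1', h2', h3', h4'⟩
    refine ⟨s ∪ s', union_subset h1 h1', h2.union h2', ?_, ?_⟩
    · rintro φ (h | h)
      exacts [h3 φ h, h3' φ h]
    · rintro u (h | h)
      · obtain ⟨φ, hφ, hu⟩ := h4 u h
        exact ⟨φ, Or.inl hφ, hu⟩
      · obtain ⟨φ, hφ, hu⟩ := h4' u h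
        exact ⟨φ, Or.inr hφ, hu⟩
  · intro u hu
    have hut : u ≠ t := fun h => ht (h ▸ hu)
    obtain ⟨_, ⟨f, hf, rfl⟩, hfne⟩ := hsep hut
    have hne : f u - f t ≠ 0 := sub_ne_zero.2 hfne
    -- The factor 2 makes |φ| > 1 an open condition around u.
    let φ : C(K, 𝕜) := (2 * (f u - f t)⁻¹) • (f - algebraMap 𝕜 C(K, 𝕜) (f t))
    have hφB : φ ∈ B := B.smul_mem (B.sub_mem hf (B.algebraMap_mem _)) _
    have hφt : φ t = 0 := by simp [φ]
    have hφu : φ u = 2 := by simp [φ, hne]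
    refine ⟨{v | 1 < ‖φ v‖}, mem_nhdsWithin_of_mem_nhds ?_, {φ}, by simpa using hφB,
      finite_singleton _, by simpa using hφt, fun v hv => ⟨φ, rfl, le_of_lt hv⟩⟩
    refine (isOpen_lt continuous_const (by fun_prop)).mem_nhds ?_
    simp [hφu]

theorem isClosed_shilovBoundary (A : Set C(K, 𝕜)) : IsClosed (shilovBoundary A) :=
  isClosed_sInter fun _ h => h.1

theorem shilovBoundary_subset {A : Set C(K, 𝕜)} {S : Set K} (hS : IsClosed S)
    (h : IsBoundary A S) : shilovBoundary A ⊆ S :=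
  sInter_subset_of_mem ⟨hS, h⟩

/-- The Shilov boundary of a point-separating algebra is itself a boundary. -/
theorem isBoundary_shilovBoundary [Nonempty K] (hsep : B.SeparatesPoints) :
    IsBoundary (B : Set C(K, 𝕜)) (shilovBoundary (B : Set C(K, 𝕜))) := by
  intro f hf
  by_contra hnot
  push Not at hnot
  let Z : Set K := {t | ‖f t‖ = ‖f‖}
  have hZ : IsClosed Z := isClosed_eq (by fun_prop) continuous_const
  -- Each point of Z lies outside some closed boundary, so it has a neighbourhood that can be
  -- deleted from every closed boundary. Compactness of Z reduces to finitely many deletions,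
  -- leaving a boundary on which f misses its norm.
  have key : ∀ F : Set K, IsClosed F → IsBoundary (B : Set C(K, 𝕜)) F →
      ∃ F', IsClosed F' ∧ IsBoundary (B : Set C(K, 𝕜)) F' ∧ F' ⊆ F ∧ Disjoint F' Z := by
    refine hZ.isCompact.induction_on (p := fun Z => ∀ F : Set K, IsClosed F →
      IsBoundary (B : Set C(K, 𝕜)) F → ∃ F', IsClosed F' ∧ IsBoundary (B : Set C(K, 𝕜)) F' ∧
        F' ⊆ F ∧ Disjoint F' Z) ?_ ?_ ?_ ?_
    · exact fun F h1 h2 => ⟨F, h1, h2, Subset.rfl, disjoint_empty F⟩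
    · intro s t hst h F h1 h2
      obtain ⟨F', a, b, c, d⟩ := h F h1 h2
      exact ⟨F', a, b, c, d.mono_right hst⟩
    · intro s t hs ht F h1 h2
      obtain ⟨F', a, b, c, d⟩ := hs F h1 h2
      obtain ⟨F'', a', b', c', d'⟩ := ht F' a b
      exact ⟨F'', a', b', c'.trans c, disjoint_union_right.2 ⟨d.mono_left c', d'⟩⟩
    · intro t ht
      have htΓ : t ∉ shilovBoundary (B : Set C(K, 𝕜)) := fun h => hnot t h ht
      obtain ⟨G, ⟨hG, hGB⟩, htG⟩ : ∃ G, (IsClosed G ∧ IsBoundary (B : Set C(K, 𝕜)) G) ∧ t ∉ G := by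
        simpa [shilovBoundary, mem_sInter, and_assoc] using htΓ
      obtain ⟨s, hsB, hsfin, hst, hsG⟩ := exists_finite_separating B hsep hG htG
      refine ⟨{t | ∀ φ ∈ s, ‖φ t‖ < 1}, mem_nhdsWithin_of_mem_nhds ?_, fun F h1 h2 => ?_⟩
      · have : {t | ∀ φ ∈ s, ‖φ t‖ < 1} = ⋂ φ ∈ s, {t | ‖φ t‖ < 1} := by ext; simp
        rw [this]
        refine (hsfin.isOpen_biInter fun φ _ =>
          isOpen_lt (by fun_prop) continuous_const).mem_nhds ?_
        simp only [mem_iInter, mem_ofPred_eq]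
        intro φ hφ
        simp [hst φ hφ]
      · obtain ⟨a, b⟩ := IsBoundary.diff_of_disjoint B hsB hsfin h1 h2 hGB hsG
        exact ⟨_, a, b, sdiff_subset, disjoint_sdiff_left⟩
  obtain ⟨F', -, hF'B, -, hdis⟩ := key univ isClosed_univ fun f _ => by
    obtain ⟨t, ht⟩ := f.exists_norm_apply_eq_norm
    exact ⟨t, mem_univ t, ht⟩
  obtain ⟨t, htF', ht⟩ := hF'B f hf
  exact disjoint_left.1 hdis htF' ht

/-- Peak functions at the Shilov boundary. -/
theorem exists_peak [Nonempty K] (hsep : B.SeparatesPoints) {U : Set K} (hU : IsOpen U)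
    (hne : (U ∩ shilovBoundary (B : Set C(K, 𝕜))).Nonempty) {ε : ℝ} (hε : 0 < ε) :
    ∃ f ∈ B, ∃ t ∈ U ∩ shilovBoundary (B : Set C(K, 𝕜)), f t = 1 ∧ (∀ s, ‖f s‖ ≤ 1) ∧
      ∀ s ∈ shilovBoundary (B : Set C(K, 𝕜)) \ U, ‖f s‖ ≤ ε := by
  set Γ := shilovBoundary (B : Set C(K, 𝕜)) with hΓ
  have hcl : IsClosed (Γ \ U) := (isClosed_shilovBoundary _).sdiff hU
  have hnot : ¬ IsBoundary (B : Set C(K, 𝕜)) (Γ \ U) := by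
    intro h
    obtain ⟨t, htU, htΓ⟩ := hne
    exact (shilovBoundary_subset hcl h htΓ).2 htU
  obtain ⟨f, hfB, hf1, r, hr0, hr1, hr⟩ := exists_norm_le_of_not_isBoundary B hcl hnot
  obtain ⟨t, htΓ, ht⟩ := isBoundary_shilovBoundary B hsep f hfB
  rw [hf1] at ht
  have htU : t ∈ U := by
    by_contra h
    have := hr t ⟨htΓ, h⟩
    linarith
  have hft : f t ≠ 0 := norm_pos_iff.1 (by rw [ht]; exact one_pos)
  obtain ⟨m, hm⟩ := exists_pow_lt_of_lt_one hε hr1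
  have hval : ∀ s, ‖(((f t)⁻¹ • f) ^ m) s‖ = ‖f s‖ ^ m := fun s => by simp [ht]
  refine ⟨((f t)⁻¹ • f) ^ m, pow_mem (B.smul_mem hfB _) m, t, ⟨htU, htΓ⟩, by simp [hft], ?_, ?_⟩
  · intro s
    rw [hval]
    exact pow_le_one₀ (norm_nonneg _) (hf1 ▸ f.norm_coe_le_norm s)
  · intro s hs
    rw [hval]
    exact (pow_le_pow_left₀ (norm_nonneg _) (hr s hs) m).trans hm.le

/-- Each new peak function lives where the previous ones are within ε of 1. At a point of Γ the
summands are thus first near 1, then arbitrary for at most one index, then near 0. The exceptional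
summand contributes at most 1 + 2 to |H| + |n - H|, which explains the constant 2; it becomes
negligible after division by n. -/
theorem exists_sum_of_peaks [Nonempty K] (hsep : B.SeparatesPoints) {ε : ℝ} (hε : 0 < ε) (n : ℕ) :
    ∀ U : Set K, IsOpen U → (U ∩ shilovBoundary (B : Set C(K, 𝕜))).Nonempty →
    ∃ H ∈ B, ∃ t ∈ U ∩ shilovBoundary (B : Set C(K, 𝕜)), ‖(n : 𝕜) - H t‖ ≤ n * ε ∧
      (∀ s ∈ shilovBoundary (B : Set C(K, 𝕜)) \ U, ‖H s‖ ≤ n * ε) ∧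
      ∀ s ∈ shilovBoundary (B : Set C(K, 𝕜)), ‖H s‖ + ‖(n : 𝕜) - H s‖ ≤ n + 2 + 2 * n * ε := by
  induction n with
  | zero =>
    rintro U hU ⟨t, ht⟩
    exact ⟨0, B.zero_mem, t, ht, by simp⟩
  | succ n ih =>
    intro U hU hne
    obtain ⟨f, hfB, t₁, ht₁, hft, hf1, hfε⟩ := exists_peak B hsep hU hne hε
    obtain ⟨H, hHB, t, ht, h1, h2, h3⟩ := ih (U ∩ {s | ‖1 - f s‖ < ε})
      (hU.inter (isOpen_lt (by fun_prop) continuous_const))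
      ⟨t₁, ⟨ht₁.1, by simpa [hft] using hε⟩, ht₁.2⟩
    have hsplit : ∀ s, ‖((n + 1 : ℕ) : 𝕜) - (f + H) s‖ ≤ ‖1 - f s‖ + ‖(n : 𝕜) - H s‖ := fun s => by
      have : ((n + 1 : ℕ) : 𝕜) - (f + H) s = (1 - f s) + ((n : 𝕜) - H s) := by
        rw [Nat.cast_succ, ContinuousMap.add_apply]; ring
      rw [this]
      exact norm_add_le _ _
    have hsplit' : ∀ s, ‖(f + H) s‖ ≤ ‖f s‖ + ‖H s‖ := fun s => norm_add_le _ _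
    have hc : ((n + 1 : ℕ) : ℝ) = n + 1 := Nat.cast_succ n
    rw [hc]
    refine ⟨f + H, B.add_mem hfB hHB, t, ⟨ht.1.1, ht.2⟩, ?_, fun s hs => ?_, fun s hs => ?_⟩
    · have := hsplit t
      have h4 : ‖1 - f t‖ < ε := ht.1.2
      linarith
    · have := hsplit' s
      have h4 := hfε s hs
      have h5 := h2 s ⟨hs.1, fun h => hs.2 h.1⟩
      linarith
    · have a1 := hsplit s
      have a2 := hsplit' s
      have a3 := hf1 s
      by_cases hsU : s ∈ U ∩ {s | ‖1 - f s‖ < ε}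
      · have a4 : ‖1 - f s‖ < ε := hsU.2
        have a5 := h3 s hs
        linarith
      · have a4 := h2 s ⟨hs, hsU⟩
        have a5 : ‖1 - f s‖ ≤ 2 := (norm_sub_le _ _).trans (by rw [norm_one]; linarith)
        have a6 : ‖(n : 𝕜) - H s‖ ≤ n + n * ε := (norm_sub_le _ _).trans (by
          rw [RCLike.norm_natCast]; linarith)
        linarith

/-- A Urysohn type lemma: peak functions whose values are close to the segment `[0, 1]`. -/
theorem exists_urysohn [Nonempty K] (hsep : B.SeparatesPoints) {U : Set K} (hU : IsOpen U)
    (hne : (U ∩ shilovBoundary (B : Set C(K, 𝕜))).Nonempty) {ε : ℝ} (hε : 0 < ε) :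
    ∃ h ∈ B, ∃ t ∈ U ∩ shilovBoundary (B : Set C(K, 𝕜)), ‖1 - h t‖ ≤ ε ∧
      (∀ s ∈ shilovBoundary (B : Set C(K, 𝕜)) \ U, ‖h s‖ ≤ ε) ∧
      ∀ s ∈ shilovBoundary (B : Set C(K, 𝕜)), ‖h s‖ + ‖1 - h s‖ ≤ 1 + ε := by
  -- With error ε / 4 per summand, (n + 2 + 2n(ε / 4)) / n = 1 + 2 / n + ε / 2, which is below 1 +
  -- ε.
  obtain ⟨n, hn⟩ := exists_nat_gt (4 / ε)
  have hn0 : (0 : ℝ) < n := lt_trans (by positivity) hn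
  have hn4 : 4 < n * ε := by rwa [div_lt_iff₀ hε] at hn
  have hnk : (n : 𝕜) ≠ 0 := by
    have : n ≠ 0 := by rintro rfl; simp at hn0
    exact_mod_cast this
  obtain ⟨H, hHB, t, ht, h1, h2, h3⟩ :=
    exists_sum_of_peaks B hsep (ε := ε / 4) (by positivity) n U hU hne
  have v1 : ∀ s, ‖((n : 𝕜)⁻¹ • H) s‖ = (n : ℝ)⁻¹ * ‖H s‖ := fun s => by
    rw [ContinuousMap.smul_apply, norm_smul, norm_inv, RCLike.norm_natCast]
  have v2 : ∀ s, ‖1 - ((n : 𝕜)⁻¹ • H) s‖ = (n : ℝ)⁻¹ * ‖(n : 𝕜) - H s‖ := fun s => by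
    have : 1 - ((n : 𝕜)⁻¹ • H) s = (n : 𝕜)⁻¹ * ((n : 𝕜) - H s) := by
      rw [ContinuousMap.smul_apply, smul_eq_mul, mul_sub, inv_mul_cancel₀ hnk]
    rw [this, norm_mul, norm_inv, RCLike.norm_natCast]
  have hnε : 0 < n * ε := by positivity
  refine ⟨(n : 𝕜)⁻¹ • H, B.smul_mem hHB _, t, ht, ?_, fun s hs => ?_, fun s hs => ?_⟩
  · rw [v2, inv_mul_le_iff₀ hn0]; linarith
  · rw [v1, inv_mul_le_iff₀ hn0]; linarith [h2 s hs]
  · rw [v1, v2, ← mul_add, inv_mul_le_iff₀ hn0]; linarith [h3 s hs]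

end ShilovBoundary

/-! ### Polynomials along sequences with bounded finite sums -/

section Polynomials

variable {F G : Type*} [NormedAddCommGroup F] [NormedAddCommGroup G]

/-- Fréchet polynomials of degree less than `n`: functions, bounded on bounded sets, whose `n`-fold
iterated differences vanish. -/
def IsFrechetPolynomial : ℕ → (F → G) → Prop
  | 0, f => ∀ x, f x = 0
  | n + 1, f => (∀ r : ℝ, ∃ C : ℝ, ∀ x, ‖x‖ ≤ r → ‖f x‖ ≤ C) ∧
      ∀ h, IsFrechetPolynomial n fun x => f (x + h) - f x

namespace IsFrechetPolynomial

theorem zero (n : ℕ) : IsFrechetPolynomial n (fun _ : F => (0 : G)) := by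
  induction n with
  | zero => exact fun _ => rfl
  | succ n ih => exact ⟨fun r => ⟨0, by simp⟩, fun h => by simpa using ih⟩

theorem add {n : ℕ} : ∀ {f g : F → G}, IsFrechetPolynomial n f → IsFrechetPolynomial n g →
    IsFrechetPolynomial n fun x => f x + g x := by
  induction n with
  | zero => exact fun hf hg x => by simp [hf x, hg x]
  | succ n ih =>
    intro f g hf hg
    refine ⟨fun r => ?_, fun h => ?_⟩
    · obtain ⟨C, hC⟩ := hf.1 r
      obtain ⟨D, hD⟩ := hg.1 r
      exact ⟨C + D, fun x hx => (norm_add_le _ _).trans (add_le_add (hC x hx) (hD x hx))⟩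
    · convert ih (hf.2 h) (hg.2 h) using 2
      exact add_sub_add_comm _ _ _ _

theorem sum {n : ℕ} {ι : Type*} (s : Finset ι) {f : ι → F → G}
    (hf : ∀ i ∈ s, IsFrechetPolynomial n (f i)) :
    IsFrechetPolynomial n fun x => ∑ i ∈ s, f i x := by
  classical
  induction s using Finset.induction_on with
  | empty => simpa using zero n
  | insert i s hi ih =>
    simp only [Finset.sum_insert hi]
    exact (hf i (by simp)).add (ih fun j hj => hf j (by simp [hj]))

theorem map {H : Type*} [NormedAddCommGroup H] (L : G →+ H) (hL : ∃ C : ℝ, ∀ x, ‖L x‖ ≤ C * ‖x‖)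
    {n : ℕ} : ∀ {f : F → G}, IsFrechetPolynomial n f → IsFrechetPolynomial n fun x => L (f x) := by
  induction n with
  | zero => exact fun hf x => by simp [hf x]
  | succ n ih =>
    refine fun hf => ⟨fun r => ?_, fun h => by simpa using ih (hf.2 h)⟩
    obtain ⟨C, hC⟩ := hL
    obtain ⟨D, hD⟩ := hf.1 r
    refine ⟨|C| * D, fun x hx => (hC _).trans ?_⟩
    exact mul_le_mul (le_abs_self C) (hD x hx) (norm_nonneg _) (abs_nonneg _)

/-- Induction on the degree. Suppose the increment along d_i is at least δ infinitely often. The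
difference of f in direction ∑ i ∈ s, d i has lower degree, so by induction the increment along a
late d_i, started from g + ∑ i ∈ s, d i, is still at least δ / 2. Adding indices greedily makes f
unbounded on a bounded set. -/
theorem tendsto_aux {n : ℕ} : ∀ {f : F → ℝ}, IsFrechetPolynomial n f → ∀ {d : ℕ → F} {C : ℝ},
    (∀ s : Finset ℕ, ‖∑ i ∈ s, d i‖ ≤ C) → ∀ (g : F) (δ : ℝ), 0 < δ →
    ∀ᶠ i in atTop, f (g + d i) - f g < δ := by
  induction n with
  | zero => exact fun hf d C hd g δ hδ => by simp [hf _, hδ]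
  | succ n ih =>
    intro f hf d C hd g δ hδ
    by_contra hnot
    rw [not_eventually] at hnot
    have grow : ∀ m : ℕ, ∃ s : Finset ℕ, m * (δ / 2) ≤ f (g + ∑ i ∈ s, d i) - f g := by
      intro m
      induction m with
      | zero => exact ⟨∅, by simp⟩
      | succ m ihm =>
        obtain ⟨s, hs⟩ := ihm
        have hneg : IsFrechetPolynomial n fun x => -(f (x + ∑ i ∈ s, d i) - f x) :=
          (hf.2 _).map (-AddMonoidHom.id ℝ) ⟨1, by simp⟩
        obtain ⟨i, hi1, hi2, hi3⟩ := (hnot.and_eventually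
          ((ih hneg hd g (δ / 2) (by positivity)).and (eventually_gt_atTop (s.sup id)))).exists
        have his : i ∉ s := fun h => absurd (Finset.le_sup (f := id) h) (not_le.2 hi3)
        refine ⟨insert i s, ?_⟩
        rw [Finset.sum_insert his, ← add_assoc]
        push_cast
        linarith [not_lt.1 hi1]
    obtain ⟨D, hD⟩ := hf.1 (‖g‖ + C)
    obtain ⟨m, hm⟩ := exists_nat_gt ((D - f g) / (δ / 2))
    rw [div_lt_iff₀ (by positivity)] at hm
    obtain ⟨s, hs⟩ := grow m
    have := (le_abs_self _).trans (hD (g + ∑ i ∈ s, d i)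
      ((norm_add_le _ _).trans (by linarith [hd s])))
    linarith

/-- Polynomials are continuous along sequences whose finite partial sums are uniformly bounded. -/
theorem tendsto {𝕜 : Type*} [RCLike 𝕜] {n : ℕ} {f : F → 𝕜} (hf : IsFrechetPolynomial n f)
    {d : ℕ → F} {C : ℝ} (hd : ∀ s : Finset ℕ, ‖∑ i ∈ s, d i‖ ≤ C) (g : F) :
    Tendsto (fun i => f (g + d i)) atTop (𝓝 (f g)) := by
  have real : ∀ {f : F → ℝ}, IsFrechetPolynomial n f →
      Tendsto (fun i => f (g + d i)) atTop (𝓝 (f g)) := by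
    intro f hf
    rw [Metric.tendsto_nhds]
    intro δ hδ
    have hneg : IsFrechetPolynomial n fun x => -f x :=
      hf.map (-AddMonoidHom.id ℝ) ⟨1, by simp⟩
    filter_upwards [hf.tendsto_aux hd g δ hδ, hneg.tendsto_aux hd g δ hδ] with i h1 h2
    rw [Real.dist_eq, abs_lt]
    constructor <;> linarith
  have hre : IsFrechetPolynomial n fun x => RCLike.re (f x) :=
    hf.map RCLike.re ⟨1, fun x => by simpa using RCLike.norm_re_le_norm x⟩
  have him : IsFrechetPolynomial n fun x => RCLike.im (f x) :=
    hf.map RCLike.im ⟨1, fun x => by simpa using RCLike.norm_im_le_norm x⟩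
  have h := ((RCLike.continuous_ofReal (K := 𝕜)).tendsto _ |>.comp (real hre)).add
    (((RCLike.continuous_ofReal (K := 𝕜)).tendsto _ |>.comp (real him)).mul_const RCLike.I)
  simpa [Function.comp_def, RCLike.re_add_im] using h

end IsFrechetPolynomial

variable {𝕜 : Type*} [RCLike 𝕜] [NormedSpace 𝕜 F] [NormedSpace 𝕜 G]

/-- Freezing the slots outside s makes the induction close: in the expansion at x + h the term with
x in all slots of s cancels, and every other term has fewer free slots. -/
theorem ContinuousMultilinearMap.isFrechetPolynomial_piecewise {k : ℕ}
    (M : ContinuousMultilinearMap 𝕜 (fun _ : Fin k => F) G) (m : ℕ) :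
    ∀ (s : Finset (Fin k)) (v : Fin k → F), s.card < m →
      IsFrechetPolynomial m fun x => M (s.piecewise (fun _ => x) v) := by
  induction m with
  | zero => exact fun s v h => absurd h (Nat.not_lt_zero _)
  | succ m ih =>
    intro s v hs
    refine ⟨fun r => ⟨‖M‖ * ∏ i, max r ‖v i‖, fun x hx => ?_⟩, fun h => ?_⟩
    · refine (M.le_opNorm _).trans ?_
      gcongr with i
      by_cases hi : i ∈ s
      · simpa [hi] using Or.inl hx
      · simp [hi]
    · have key : ∀ x, M (s.piecewise (fun _ => x + h) v) - M (s.piecewise (fun _ => x) v) =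
          ∑ r ∈ s.ssubsets, M (r.piecewise (fun _ => x) (s.piecewise (fun _ => h) v)) := by
        intro x
        have h1 := M.toMultilinearMap.map_piecewise_add (fun _ => x) (s.piecewise (fun _ => h) v) s
        have e1 : s.piecewise ((fun _ => x) + s.piecewise (fun _ => h) v)
            (s.piecewise (fun _ => h) v) = s.piecewise (fun _ => x + h) v := by
          ext i; by_cases hi : i ∈ s <;> simp [hi]
        have e2 : s.piecewise (fun _ => x) (s.piecewise (fun _ => h) v) =
            s.piecewise (fun _ => x) v := by
          ext i; by_cases hi : i ∈ s <;> simp [hi]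
        rw [e1, ← Finset.insert_erase (Finset.mem_powerset_self s), Finset.sum_insert (by simp),
          e2] at h1
        exact sub_eq_iff_eq_add'.2 h1
      simp only [key]
      refine IsFrechetPolynomial.sum _ fun r hr => ih r _ ?_
      exact lt_of_lt_of_le (Finset.card_lt_card (Finset.mem_ssubsets.1 hr)) (Nat.lt_succ_iff.1 hs)

theorem IsContinuousPolynomial.isFrechetPolynomial {P : F → F} (hP : IsContinuousPolynomial 𝕜 P)
    (φ : StrongDual 𝕜 F) : ∃ n, IsFrechetPolynomial n fun x => φ (P x) := by
  obtain ⟨p, n, h⟩ := hP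
  refine ⟨n, ?_⟩
  simp only [h]
  refine IsFrechetPolynomial.map (φ : F →+ 𝕜) ⟨‖φ‖, φ.le_opNorm⟩
    (IsFrechetPolynomial.sum _ fun k hk => ?_)
  simpa using (p k).isFrechetPolynomial_piecewise n Finset.univ 0 (by simpa using hk)

theorem ContinuousLinearMap.isFrechetPolynomial (φ : F →L[𝕜] G) :
    IsFrechetPolynomial 2 fun x => φ x :=
  ⟨fun r => ⟨‖φ‖ * r, fun x hx => (φ.le_opNorm x).trans (by gcongr)⟩, fun h =>
    ⟨fun _ => ⟨‖φ h‖, by simp⟩, fun h' x => by simp⟩⟩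

theorem IsContinuousPolynomial.continuous {P : F → F} (hP : IsContinuousPolynomial 𝕜 P) :
    Continuous P := by
  obtain ⟨p, n, h⟩ := hP
  rw [show P = _ from funext h]
  fun_prop

end Polynomials

/-! ### Perturbing functions near a point of the Shilov boundary -/

section Perturbation

variable {𝕜 : Type*} [RCLike 𝕜] {K : Type*} [TopologicalSpace K] [CompactSpace K]
  {X : Type*} [NormedAddCommGroup X] [NormedSpace 𝕜 X] {E : Submodule 𝕜 C(K, X)}

namespace IsAKXSpace

theorem isBoundary [Nonempty K] (hE : IsAKXSpace E) :
    IsBoundary (baseAlgebra E) (shilovBoundary (baseAlgebra E)) := by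
  obtain ⟨B, hB, -, hsep⟩ := hE.base_isUniformAlgebra
  rw [← hB]
  exact isBoundary_shilovBoundary B hsep

theorem exists_mem_norm_eq [Nonempty K] (hE : IsAKXSpace E) (g : E) :
    ∃ t ∈ shilovBoundary (baseAlgebra E), ‖g.1 t‖ = ‖g‖ := by
  obtain ⟨s, hs⟩ := g.1.exists_norm_apply_eq_norm
  obtain ⟨φ, hφ, hφs⟩ := exists_dual_vector'' 𝕜 (g.1 s)
  let f : C(K, 𝕜) := ⟨fun t => φ (g.1 t), by fun_prop⟩
  obtain ⟨t, ht, hft⟩ := hE.isBoundary f ⟨φ, g.1, g.2, fun _ => rfl⟩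
  refine ⟨t, ht, le_antisymm (g.1.norm_coe_le_norm t) ?_⟩
  calc ‖g‖ = ‖f s‖ := by
        change ‖g.1‖ = ‖φ (g.1 s)‖
        rw [hφs, RCLike.norm_ofReal, abs_of_nonneg (norm_nonneg _), hs]
    _ ≤ ‖f‖ := f.norm_coe_le_norm s
    _ = ‖φ (g.1 t)‖ := hft.symm
    _ ≤ ‖g.1 t‖ := (φ.le_of_opNorm_le hφ _).trans_eq (one_mul _)

theorem norm_le [Nonempty K] (hE : IsAKXSpace E) (g : E) {C : ℝ}
    (h : ∀ t ∈ shilovBoundary (baseAlgebra E), ‖g.1 t‖ ≤ C) : ‖g‖ ≤ C := by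
  obtain ⟨t, ht, hgt⟩ := hE.exists_mem_norm_eq g
  exact hgt ▸ h t ht

/-- The perturbation `h • (a - g)`, moving `g` towards `a` where `h` is close to `1`. -/
def bump (hE : IsAKXSpace E) (h : baseAlgebra E) (a : X) (g : E) : E :=
  ⟨h.1 • (ContinuousMap.const K a - g.1), by
    rw [smul_sub]
    exact E.sub_mem (hE.tensor_mem _ h.2 a) (hE.mul_mem _ h.2 _ g.2)⟩

theorem bump_apply (hE : IsAKXSpace E) (h : baseAlgebra E) (a : X) (g : E) (t : K) :
    (hE.bump h a g).1 t = h.1 t • (a - g.1 t) := rfl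

theorem add_bump_apply (hE : IsAKXSpace E) (h : baseAlgebra E) (a : X) (g : E) (t : K) :
    (g + hE.bump h a g).1 t = h.1 t • a + (1 - h.1 t) • g.1 t := by
  change g.1 t + h.1 t • (a - g.1 t) = _
  module

omit [CompactSpace K] in
theorem sum_coe_apply {ι : Type*} (s : Finset ι) (f : ι → E) (t : K) :
    (∑ i ∈ s, f i).1 t = ∑ i ∈ s, (f i).1 t := by
  rw [AddSubmonoidClass.coe_finsetSum, ContinuousMap.sum_apply]

/-- The perturbed function is h a + (1 - h) g, which is affine in g. This allows convex combinations
of slices to be treated one slice at a time. -/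
theorem sum_add_bump (hE : IsAKXSpace E) (h : baseAlgebra E) (a : X) {m : ℕ} {c : Fin m → 𝕜}
    (y : Fin m → E) (hc : ∑ i, c i = 1) :
    ∑ i, c i • y i + hE.bump h a (∑ i, c i • y i) = ∑ i, c i • (y i + hE.bump h a (y i)) := by
  ext t
  rw [add_bump_apply, sum_coe_apply, sum_coe_apply]
  have key : ∀ i, (c i • (y i + hE.bump h a (y i))).1 t =
      c i • h.1 t • a + (1 - h.1 t) • (c i • y i).1 t := fun i => by
    change c i • (y i + hE.bump h a (y i)).1 t = _ + _ • c i • (y i).1 t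
    rw [add_bump_apply]; module
  simp only [key]
  rw [Finset.sum_add_distrib, ← Finset.sum_smul, hc, one_smul, ← Finset.smul_sum]

theorem norm_add_bump_le [Nonempty K] (hE : IsAKXSpace E) {h : baseAlgebra E} {a : X} {g : E}
    {δ R : ℝ} (hh : ∀ t ∈ shilovBoundary (baseAlgebra E), ‖h.1 t‖ + ‖1 - h.1 t‖ ≤ 1 + δ)
    (ha : ‖a‖ ≤ R) (hg : ‖g‖ ≤ R) : ‖g + hE.bump h a g‖ ≤ (1 + δ) * R := by
  refine hE.norm_le _ fun t ht => ?_
  have hR : 0 ≤ R := (norm_nonneg a).trans ha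
  rw [add_bump_apply]
  calc ‖h.1 t • a + (1 - h.1 t) • g.1 t‖ ≤ ‖h.1 t‖ * ‖a‖ + ‖1 - h.1 t‖ * ‖g.1 t‖ := by
        refine (norm_add_le _ _).trans ?_
        rw [norm_smul, norm_smul]
    _ ≤ ‖h.1 t‖ * R + ‖1 - h.1 t‖ * R := by
        gcongr
        exact (g.1.norm_coe_le_norm t).trans hg
    _ = (‖h.1 t‖ + ‖1 - h.1 t‖) * R := by ring
    _ ≤ (1 + δ) * R := mul_le_mul_of_nonneg_right (hh t ht) hR

/-- Supplies the bounded finite sums required by `IsFrechetPolynomial.tendsto`. -/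
theorem norm_sum_bump_le [Nonempty K] (hE : IsAKXSpace E) {h : ℕ → baseAlgebra E} {C : ℝ}
    (hh : ∀ t ∈ shilovBoundary (baseAlgebra E), ∀ s : Finset ℕ, ∑ i ∈ s, ‖(h i).1 t‖ ≤ C)
    (a : X) (g : E) (s : Finset ℕ) : ‖∑ i ∈ s, hE.bump (h i) a g‖ ≤ C * (‖a‖ + ‖g‖) := by
  refine hE.norm_le _ fun t ht => ?_
  rw [sum_coe_apply]
  calc ‖∑ i ∈ s, (hE.bump (h i) a g).1 t‖ ≤ ∑ i ∈ s, ‖(h i).1 t‖ * (‖a‖ + ‖g‖) := by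
        refine norm_sum_le_of_le _ fun i _ => ?_
        rw [bump_apply, norm_smul]
        gcongr
        exact (norm_sub_le _ _).trans (by gcongr; exact g.1.norm_coe_le_norm t)
    _ = (∑ i ∈ s, ‖(h i).1 t‖) * (‖a‖ + ‖g‖) := by rw [Finset.sum_mul]
    _ ≤ C * (‖a‖ + ‖g‖) := by gcongr; exact hh t ht s

theorem norm_add_bump_apply_sub_le (hE : IsAKXSpace E) {h : baseAlgebra E} {a : X} {g : E}
    {δ R : ℝ} {t : K} (hδ : ‖1 - h.1 t‖ ≤ δ) (ha : ‖a‖ ≤ R) (hg : ‖g‖ ≤ R) :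
    ‖(g + hE.bump h a g).1 t - a‖ ≤ δ * (2 * R) := by
  have : (g + hE.bump h a g).1 t - a = (1 - h.1 t) • (g.1 t - a) := by
    rw [add_bump_apply]; module
  rw [this, norm_smul]
  have h1 : ‖g.1 t - a‖ ≤ 2 * R :=
    (norm_sub_le _ _).trans (by linarith [(g.1.norm_coe_le_norm t).trans hg])
  exact mul_le_mul hδ h1 (norm_nonneg _) ((norm_nonneg _).trans hδ)

end IsAKXSpace

/-- Almost disjoint Urysohn functions concentrating near a non-isolated point of the Shilov
boundary. -/
structure IsBumpSequence (E : Submodule 𝕜 C(K, X)) (U : Set K) (h : ℕ → baseAlgebra E)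
    (τ : ℕ → K) (δ : ℕ → ℝ) : Prop where
  tendsto : Tendsto δ atTop (𝓝 0)
  pos : ∀ n, 0 < δ n
  mem : ∀ n, τ n ∈ U
  peak : ∀ n, ‖1 - (h n).1 (τ n)‖ ≤ δ n
  segment : ∀ n, ∀ t ∈ shilovBoundary (baseAlgebra E), ‖(h n).1 t‖ + ‖1 - (h n).1 t‖ ≤ 1 + δ n
  sum_le : ∀ t ∈ shilovBoundary (baseAlgebra E), ∀ s : Finset ℕ, ∑ i ∈ s, ‖(h i).1 t‖ ≤ 4

/-- A non-isolated point makes U ∩ Γ infinite, so it contains a sequence of disjoint nonempty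
relatively open sets, each carrying a Urysohn function with error 2⁻ⁿ. The bound 4 is 2 for the
summed errors plus 2 for the at most one set containing t. -/
theorem IsAKXSpace.exists_isBumpSequence [T2Space K] [Nonempty K] (hE : IsAKXSpace E)
    (hΓ : ∀ t ∈ shilovBoundary (baseAlgebra E), AccPt t (𝓟 (shilovBoundary (baseAlgebra E))))
    {U : Set K} (hU : IsOpen U) {t₀ : K} (ht₀ : t₀ ∈ shilovBoundary (baseAlgebra E))
    (ht₀U : t₀ ∈ U) : ∃ h τ δ, IsBumpSequence E U h τ δ := by
  obtain ⟨B, hB, -, hsep⟩ := hE.base_isUniformAlgebra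
  set Γ := shilovBoundary (baseAlgebra E) with hΓdef
  have hinf : (U ∩ Γ).Infinite :=
    Set.Infinite.of_accPt ((hΓ t₀ ht₀).nhds_inter (hU.mem_nhds ht₀U))
  have : Infinite (U ∩ Γ : Set K) := hinf.to_subtype
  obtain ⟨V, hVinf, hVo, hVd⟩ := exists_seq_infinite_isOpen_pairwise_disjoint (U ∩ Γ : Set K)
  choose W hWo hWV using fun n => isOpen_induced_iff.1 (hVo n)
  let δ : ℕ → ℝ := fun n => (1 / 2) ^ n
  have hδ : ∀ n, 0 < δ n := fun n => by positivity
  have hne : ∀ n, ((U ∩ W n) ∩ Γ).Nonempty := fun n => by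
    obtain ⟨⟨t, ht⟩, htV⟩ := (hVinf n).nonempty
    rw [← hWV] at htV
    exact ⟨t, ⟨ht.1, htV⟩, ht.2⟩
  have hdisj : ∀ t ∈ Γ, ∀ i j, t ∈ U ∩ W i → t ∈ U ∩ W j → i = j := fun t ht i j hi hj => by
    by_contra hij
    have hV : ∀ k, t ∈ U ∩ W k → (⟨t, hi.1, ht⟩ : (U ∩ Γ : Set K)) ∈ V k := fun k hk => by
      rw [← hWV]; exact hk.2
    exact disjoint_left.1 (hVd hij) (hV i hi) (hV j hj)
  have hex := fun n => exists_urysohn B hsep (hU.inter (hWo n)) (by rw [hB]; exact hne n) (hδ n)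
  rw [hB, ← hΓdef] at hex
  choose h hhB τ hτ h1 h2 h3 using hex
  refine ⟨fun n => ⟨h n, hB ▸ hhB n⟩, τ, δ,
    tendsto_pow_atTop_nhds_zero_of_lt_one (by norm_num) (by norm_num), hδ,
    fun n => (hτ n).1.1, h1, h3, fun t ht s => ?_⟩
  classical
  have hle : ∀ i, ‖h i t‖ ≤ δ i + if t ∈ U ∩ W i then 2 else 0 := fun i => by
    split_ifs with hi
    · have := h3 i t ht
      have h5 : δ i ≤ 1 := pow_le_one₀ (by norm_num) (by norm_num)
      linarith [norm_nonneg (1 - h i t), hδ i]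
    · simpa using h2 i t ⟨ht, hi⟩
  calc ∑ i ∈ s, ‖h i t‖ ≤ ∑ i ∈ s, (δ i + if t ∈ U ∩ W i then 2 else 0) :=
        Finset.sum_le_sum fun i _ => hle i
    _ = ∑ i ∈ s, δ i + ∑ i ∈ s, (if t ∈ U ∩ W i then 2 else 0) := Finset.sum_add_distrib
    _ ≤ 2 + 2 := by
        gcongr
        · exact (summable_geometric_two.sum_le_tsum s fun i _ => (hδ i).le).trans_eq
            tsum_geometric_two
        · by_cases hex : ∃ j, t ∈ U ∩ W j
          · obtain ⟨j, hj⟩ := hex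
            have : ∀ i ∈ s, (if t ∈ U ∩ W i then (2 : ℝ) else 0) ≤ if i = j then 2 else 0 := by
              intro i _
              by_cases hi : t ∈ U ∩ W i
              · rw [if_pos hi, if_pos (hdisj t ht i j hi hj)]
              · rw [if_neg hi]; split_ifs <;> norm_num
            refine (Finset.sum_le_sum this).trans ?_
            rw [Finset.sum_ite_eq']
            split_ifs <;> norm_num
          · refine (Finset.sum_eq_zero fun i _ => if_neg fun hi => hex ⟨i, hi⟩).le.trans
              (by norm_num)
    _ = 4 := by norm_num

theorem IsBumpSequence.tendsto_polynomial [Nonempty K] {U : Set K} {h : ℕ → baseAlgebra E}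
    {τ : ℕ → K} {δ : ℕ → ℝ} (H : IsBumpSequence E U h τ δ) (hE : IsAKXSpace E) {n : ℕ} {p : E → 𝕜}
    (hp : IsFrechetPolynomial n p) (a : X) (g : E) :
    Tendsto (fun i => p (g + hE.bump (h i) a g)) atTop (𝓝 (p g)) :=
  hp.tendsto (hE.norm_sum_bump_le H.sum_le a g) g

/-- If the Shilov boundary is perfect, there are affine self-maps of the unit ball, converging
weakly to the identity, which move a given point of the sphere to almost antipodal positions. -/
theorem IsAKXSpace.exists_diametral_maps [T2Space K] [Nonempty K] (hE : IsAKXSpace E)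
    (hΓ : ∀ t ∈ shilovBoundary (baseAlgebra E), AccPt t (𝓟 (shilovBoundary (baseAlgebra E))))
    {x : E} (hx : ‖x‖ = 1) {ε : ℝ} (hε : 0 < ε) :
    ∃ T : ℕ → E → E, (∀ n g, ‖g‖ ≤ 1 → ‖T n g‖ ≤ 1) ∧
      (∀ g, ∀ φ : StrongDual 𝕜 E, Tendsto (fun n => φ (T n g)) atTop (𝓝 (φ g))) ∧
      (∀ n, ∀ {m : ℕ} (c : Fin m → 𝕜) (y : Fin m → E), ∑ i, c i = 1 →
        T n (∑ i, c i • y i) = ∑ i, c i • T n (y i)) ∧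
      ∀ᶠ n in atTop, 2 - ε < ‖x - T n x‖ := by
  obtain ⟨t₀, ht₀, hxt₀⟩ := hE.exists_mem_norm_eq x
  rw [hx] at hxt₀
  let a : X := -(x.1 t₀)
  have ha : ‖a‖ ≤ 1 := by simp only [a, norm_neg, hxt₀, le_refl]
  obtain ⟨h, τ, δ, H⟩ := hE.exists_isBumpSequence hΓ (U := {t | ‖x.1 t - x.1 t₀‖ < ε / 2})
    (isOpen_lt (by fun_prop) continuous_const) ht₀ (by simpa using half_pos hε)
  have hpos : ∀ n, 0 < 1 + δ n := fun n => by linarith [H.pos n]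
  have hnorm : ∀ n, ‖(((1 + δ n)⁻¹ : ℝ) : 𝕜)‖ = (1 + δ n)⁻¹ := fun n => by
    rw [RCLike.norm_ofReal, abs_of_pos (inv_pos.2 (hpos n))]
  -- The factor (1 + δ n)⁻¹ brings the image of the unit ball back into the unit ball; it tends to
  -- 1, so weak limits are unaffected.
  refine ⟨fun n g => (((1 + δ n)⁻¹ : ℝ) : 𝕜) • (g + hE.bump (h n) a g), ?_, ?_, ?_, ?_⟩
  · intro n g hg
    rw [norm_smul, hnorm, inv_mul_le_iff₀ (hpos n)]
    exact hE.norm_add_bump_le (H.segment n) ha hg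
  · intro g φ
    have h1 : Tendsto (fun n => (((1 + δ n)⁻¹ : ℝ) : 𝕜)) atTop (𝓝 (((1 + 0)⁻¹ : ℝ) : 𝕜)) :=
      (RCLike.continuous_ofReal.tendsto _).comp
        ((tendsto_const_nhds.add H.tendsto).inv₀ (by norm_num))
    have h2 := h1.mul (H.tendsto_polynomial hE φ.isFrechetPolynomial a g)
    rw [show ((((1 + 0)⁻¹ : ℝ) : 𝕜)) * φ g = φ g by simp] at h2
    exact h2.congr fun n => by rw [map_smul, smul_eq_mul]
  · intro n m c y hc
    simp only [smul_comm _ (((1 + δ n)⁻¹ : ℝ) : 𝕜), ← Finset.smul_sum]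
    rw [hE.sum_add_bump _ a y hc]
  -- At τ n, x is within ε / 2 of x(t₀) and z within 2 δ n of -x(t₀); rescaling z costs another δ n.
  -- Hence δ n < ε / 6 suffices.
  · filter_upwards [H.tendsto.eventually (gt_mem_nhds (show 0 < ε / 6 by positivity))] with n hn
    set z := x + hE.bump (h n) a x with hz
    have hδ := H.pos n
    have h1 : ‖z.1 (τ n) - a‖ ≤ δ n * (2 * 1) :=
      hE.norm_add_bump_apply_sub_le (H.peak n) ha hx.le
    have h2 : ‖x.1 (τ n) - x.1 t₀‖ < ε / 2 := H.mem n
    have h3 : ‖z‖ ≤ (1 + δ n) * 1 := hE.norm_add_bump_le (H.segment n) ha hx.le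
    have h4 : ‖z - (((1 + δ n)⁻¹ : ℝ) : 𝕜) • z‖ ≤ δ n := by
      have : z - (((1 + δ n)⁻¹ : ℝ) : 𝕜) • z = ((1 - (1 + δ n)⁻¹ : ℝ) : 𝕜) • z := by
        push_cast; module
      have h5 : 1 - (1 + δ n)⁻¹ = δ n * (1 + δ n)⁻¹ := by field_simp [(hpos n).ne']; ring
      rw [this, norm_smul, RCLike.norm_ofReal, h5, abs_of_nonneg
        (mul_nonneg hδ.le (inv_nonneg.2 (hpos n).le)), mul_assoc]
      refine mul_le_of_le_one_right hδ.le ?_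
      rw [inv_mul_le_iff₀ (hpos n)]
      exact h3
    have h6 : ‖x.1 (τ n) - z.1 (τ n)‖ ≤ ‖x - z‖ := (x.1 - z.1).norm_coe_le_norm (τ n)
    have h7 : (2 : ℝ) = ‖(2 : 𝕜) • x.1 t₀‖ := by rw [norm_smul, hxt₀]; simp
    have h8 : (2 : 𝕜) • x.1 t₀ = (x.1 (τ n) - z.1 (τ n)) + (z.1 (τ n) - a)
        - (x.1 (τ n) - x.1 t₀) := by simp only [a]; module
    have h9 : (2 : ℝ) ≤ ‖x.1 (τ n) - z.1 (τ n)‖ + ‖z.1 (τ n) - a‖ + ‖x.1 (τ n) - x.1 t₀‖ := by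
      rw [h7, h8]
      exact (norm_sub_le _ _).trans (by gcongr; exact norm_add_le _ _)
    have h10 : ‖x - z‖ ≤ ‖x - (((1 + δ n)⁻¹ : ℝ) : 𝕜) • z‖ +
        ‖z - (((1 + δ n)⁻¹ : ℝ) : 𝕜) • z‖ := by
      have := norm_sub_le (x - (((1 + δ n)⁻¹ : ℝ) : 𝕜) • z) (z - (((1 + δ n)⁻¹ : ℝ) : 𝕜) • z)
      rwa [sub_sub_sub_cancel_right] at this
    linarith

end Perturbation

/-! ### Diametral diameter two properties -/

section DiametralProperties

theorem isLUB_norm_sub_image {Y : Type*} [NormedAddCommGroup Y] {C : Set Y} {x : Y}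
    (hC : ∀ y ∈ C, ‖y‖ ≤ 1) (hx : ‖x‖ ≤ 1) (h : ∀ ε > 0, ∃ y ∈ C, 2 - ε < ‖x - y‖) :
    IsLUB ((fun y => ‖x - y‖) '' C) 2 := by
  refine ⟨?_, fun b hb => le_of_forall_pos_sub_le fun ε hε => ?_⟩
  · rintro _ ⟨y, hy, rfl⟩
    exact (norm_sub_le _ _).trans (by linarith [hC y hy])
  · obtain ⟨y, hy, hlt⟩ := h ε hε
    exact hlt.le.trans (hb ⟨y, hy, rfl⟩)

variable {𝕜 : Type*} [RCLike 𝕜] {K : Type*} [TopologicalSpace K] [CompactSpace K] [T2Space K]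
  [Nonempty K] {X : Type*} [NormedAddCommGroup X] [NormedSpace 𝕜 X] {E : Submodule 𝕜 C(K, X)}

theorem IsAKXSpace.hasDD2P (hE : IsAKXSpace E)
    (hΓ : ∀ t ∈ shilovBoundary (baseAlgebra E), AccPt t (𝓟 (shilovBoundary (baseAlgebra E)))) :
    HasDD2P 𝕜 E := by
  rintro W - ⟨U, hU, rfl⟩ x ⟨⟨hxB, hxU⟩, hxS⟩
  have hx : ‖x‖ = 1 := by simpa using hxS
  refine isLUB_norm_sub_image (fun y hy => by simpa using hy.1) hx.le fun ε hε => ?_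
  obtain ⟨T, hT1, hT2, -, hT3⟩ := hE.exists_diametral_maps hΓ hx hε
  have hw : Tendsto (fun n => toWeakSpace 𝕜 E (T n x)) atTop (𝓝 (toWeakSpace 𝕜 E x)) := by
    refine (WeakBilin.tendsto_iff_forall_eval_tendsto (topDualPairing 𝕜 E).flip ?_).2 (hT2 x)
    -- The weak pairing separates points, by Hahn–Banach.
    intro u v huv
    by_contra hne
    obtain ⟨φ, -, hφ⟩ := exists_dual_vector 𝕜 (u - v : E) (norm_ne_zero_iff.2 (sub_ne_zero.2 hne))
    have h1 : φ u = φ v := LinearMap.congr_fun huv φ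
    rw [map_sub, h1, sub_self] at hφ
    exact norm_ne_zero_iff.2 (sub_ne_zero.2 hne) (by exact_mod_cast hφ.symm)
  obtain ⟨n, hn1, hn2⟩ := ((hw.eventually (hU.mem_nhds hxU)).and hT3).exists
  exact ⟨T n x, ⟨by simpa using hT1 n x hx.le, hn1⟩, hn2⟩

/-- Write x = ∑ c_i y_i. Since T_n y_i → y_i weakly, each T_n y_i eventually stays in its slice, and
affinity of T_n keeps T_n x = ∑ c_i T_n y_i in C. -/
theorem IsAKXSpace.hasRestrictedDSD2P (hE : IsAKXSpace E)
    (hΓ : ∀ t ∈ shilovBoundary (baseAlgebra E), AccPt t (𝓟 (shilovBoundary (baseAlgebra E)))) :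
    HasRestrictedDSD2P 𝕜 E := by
  rintro _ ⟨m, c, S, hc0, hc1, hS, rfl⟩ x ⟨⟨hxB, y, hy, hxy⟩, hxS⟩
  have hx : ‖x‖ = 1 := by simpa using hxS
  refine isLUB_norm_sub_image (fun y hy => by simpa using hy.1) hx.le fun ε hε => ?_
  obtain ⟨T, hT1, hT2, hT4, hT3⟩ := hE.exists_diametral_maps hΓ hx hε
  have hev : ∀ i, ∀ᶠ n in atTop, T n (y i) ∈ S i := by
    intro i
    obtain ⟨φ, -, η, hη, hSi⟩ := hS i
    have hyi := hy i
    rw [hSi] at hyi ⊢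
    filter_upwards [((RCLike.continuous_re.tendsto _).comp (hT2 (y i) φ)).eventually
      (lt_mem_nhds hyi.2)] with n hn
    exact ⟨by simpa using hT1 n (y i) (by simpa using hyi.1), hn⟩
  obtain ⟨n, hn1, hn2⟩ := ((eventually_all.2 hev).and hT3).exists
  refine ⟨T n x, ⟨by simpa using hT1 n x hx.le, fun i => T n (y i), hn1, ?_⟩, hn2⟩
  rw [hxy]
  exact hT4 n _ y (by exact_mod_cast hc1)

theorem HasRestrictedDSD2P.hasDLD2P {Y : Type*} [NormedAddCommGroup Y] [NormedSpace 𝕜 Y]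
    (h : HasRestrictedDSD2P 𝕜 Y) : HasDLD2P 𝕜 Y := by
  intro S hS
  refine h S ⟨1, fun _ => 1, fun _ => S, by simp, by simp, fun _ => hS, ?_⟩
  ext x
  constructor
  · intro hx
    obtain ⟨φ, -, η, -, rfl⟩ := hS
    exact ⟨hx.1, fun _ => x, by simpa using hx, by simp⟩
  · rintro ⟨-, y, hy, rfl⟩
    simpa using hy 0

theorem HasDD2P.hasDLD2P {Y : Type*} [NormedAddCommGroup Y] [NormedSpace 𝕜 Y]
    (h : HasDD2P 𝕜 Y) : HasDLD2P 𝕜 Y := by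
  rintro S ⟨φ, -, ε, -, rfl⟩ x hx
  refine h _ ⟨x, hx.1⟩ ⟨{y | sSup ((fun y => RCLike.re (φ y)) '' Metric.closedBall (0 : Y) 1) - ε <
    RCLike.re ((topDualPairing 𝕜 Y).flip y φ)}, ?_, rfl⟩ x hx
  exact isOpen_lt continuous_const
    (RCLike.continuous_re.comp (WeakBilin.eval_continuous (topDualPairing 𝕜 Y).flip φ))

end DiametralProperties

/-! ### The polynomial Daugavet property -/

section PolynomialDaugavet

variable {𝕜 : Type*} [RCLike 𝕜] {K : Type*} [TopologicalSpace K] [CompactSpace K] [T2Space K]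
  [Nonempty K] {X : Type*} [NormedAddCommGroup X] [NormedSpace 𝕜 X] {E : Submodule 𝕜 C(K, X)}

/-- The functional `g ↦ φ (g t)`. -/
def pointFunctional (E : Submodule 𝕜 C(K, X)) (φ : StrongDual 𝕜 X) (t : K) : StrongDual 𝕜 E :=
  φ ∘L (ContinuousMap.evalCLM 𝕜 t) ∘L E.subtypeL

/-- All conditions on g are finitely many strict inequalities on polynomial values and on the norm,
so they survive a late bump. The bump also brings the value at the new point τ n close to a. -/
theorem IsAKXSpace.exists_bump_step (hE : IsAKXSpace E)
    (hΓ : ∀ t ∈ shilovBoundary (baseAlgebra E), AccPt t (𝓟 (shilovBoundary (baseAlgebra E))))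
    {P : E → E} (hP : IsContinuousPolynomial 𝕜 P) {t₀ : K}
    (ht₀ : t₀ ∈ shilovBoundary (baseAlgebra E)) (φ : StrongDual 𝕜 X) {a : X} (ha : ‖a‖ < 1)
    {c : 𝕜} {ε η : ℝ} (hε : 0 < ε) {g : E} (hg : ‖g‖ < 1) (hc : ‖φ ((P g).1 t₀) - c‖ < η)
    {S : Set K} (hS : S.Finite) (hgS : ∀ t ∈ S, ‖φ (g.1 t) - φ a‖ < ε) {U : Set K} (hU : IsOpen U)
    (ht₀U : t₀ ∈ U) :
    ∃ g' : E, ∃ t ∈ U, ‖g'‖ < 1 ∧ ‖φ ((P g').1 t₀) - c‖ < η ∧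
      ∀ s ∈ insert t S, ‖φ (g'.1 s) - φ a‖ < ε := by
  obtain ⟨h, τ, δ, H⟩ := hE.exists_isBumpSequence hΓ hU ht₀ ht₀U
  set R := max ‖g‖ ‖a‖ with hR
  have hR1 : R < 1 := max_lt hg ha
  have e1 : ∀ᶠ n in atTop, ‖g + hE.bump (h n) a g‖ < 1 := by
    have : Tendsto (fun n => (1 + δ n) * R) atTop (𝓝 ((1 + 0) * R)) :=
      (tendsto_const_nhds.add H.tendsto).mul_const R
    filter_upwards [this.eventually (gt_mem_nhds (by simpa using hR1))] with n hn
    exact (hE.norm_add_bump_le (H.segment n) (le_max_right _ _) (le_max_left _ _)).trans_lt hn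
  have e2 : ∀ᶠ n in atTop, ‖φ ((P (g + hE.bump (h n) a g)).1 t₀) - c‖ < η := by
    obtain ⟨m, hm⟩ := hP.isFrechetPolynomial (pointFunctional E φ t₀)
    exact ((H.tendsto_polynomial hE hm a g).sub_const c).norm.eventually (gt_mem_nhds hc)
  have e3 : ∀ᶠ n in atTop, ∀ s ∈ S, ‖φ ((g + hE.bump (h n) a g).1 s) - φ a‖ < ε := by
    refine (eventually_all_finite hS).2 fun s hs => ?_
    exact ((H.tendsto_polynomial hE (pointFunctional E φ s).isFrechetPolynomial a g).sub_const
      (φ a)).norm.eventually (gt_mem_nhds (hgS s hs))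
  have e4 : ∀ᶠ n in atTop, ‖φ ((g + hE.bump (h n) a g).1 (τ n)) - φ a‖ < ε := by
    have : Tendsto (fun n => ‖φ‖ * (δ n * (2 * R))) atTop (𝓝 (‖φ‖ * (0 * (2 * R)))) :=
      (H.tendsto.mul_const _).const_mul _
    filter_upwards [this.eventually (gt_mem_nhds (by simpa using hε))] with n hn
    rw [← map_sub]
    refine (φ.le_opNorm _).trans_lt (lt_of_le_of_lt ?_ hn)
    gcongr
    exact hE.norm_add_bump_apply_sub_le (H.peak n) (le_max_right _ _) (le_max_left _ _)
  obtain ⟨n, h1, h2, h3, h4⟩ := (e1.and (e2.and (e3.and e4))).exists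
  exact ⟨_, τ n, H.mem n, h1, h2, forall_mem_insert.2 ⟨h4, h3⟩⟩

/-- A weakly compact polynomial cannot distinguish `f` near a non-isolated point `t₀` of the Shilov
boundary from suitable functions taking there a prescribed value `a`. -/
theorem IsAKXSpace.exists_polynomial_near (hE : IsAKXSpace E)
    (hΓ : ∀ t ∈ shilovBoundary (baseAlgebra E), AccPt t (𝓟 (shilovBoundary (baseAlgebra E))))
    {P : E → E} (hP : IsContinuousPolynomial 𝕜 P) (hPw : IsWeaklyCompactMap 𝕜 P) {f : E}
    (hf : ‖f‖ < 1) {t₀ : K} (ht₀ : t₀ ∈ shilovBoundary (baseAlgebra E)) (φ : StrongDual 𝕜 X)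
    {a : X} (ha : ‖a‖ < 1) {ε : ℝ} (hε : 0 < ε) :
    ∃ g : E, ∃ t, ‖g‖ < 1 ∧ ‖φ (g.1 t) - φ a‖ < ε ∧
      ‖φ ((P g).1 t) - φ ((P f).1 t₀)‖ < ε := by
  by_contra! hno
  set c := φ ((P f).1 t₀) with hc
  have hη : 0 < ε / 2 := by positivity
  have hopen : ∀ g : E, IsOpen {t | ‖φ ((P g).1 t) - c‖ < ε / 2} := fun g =>
    isOpen_lt (by fun_prop) continuous_const
  -- A state (g, S, U) holds the current function, the points where φ ∘ g is already near φ a, and a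
  -- neighbourhood of t₀ on which φ ∘ P g is near c.
  let Good : E × Set K × Set K → Prop := fun s =>
    ‖s.1‖ < 1 ∧ ‖φ ((P s.1).1 t₀) - c‖ < ε / 2 ∧ s.2.1.Finite ∧
      (∀ t ∈ s.2.1, ‖φ (s.1.1 t) - φ a‖ < ε) ∧ IsOpen s.2.2 ∧ t₀ ∈ s.2.2 ∧
      ∀ t ∈ s.2.2, ‖φ ((P s.1).1 t) - c‖ < ε / 2
  have step : ∀ s : {s // Good s}, ∃ s' : {s // Good s}, ∃ t ∈ s.1.2.2, t ∈ s'.1.2.1 ∧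
      s.1.2.1 ⊆ s'.1.2.1 ∧ s'.1.2.2 ⊆ s.1.2.2 := by
    rintro ⟨⟨g, S, U⟩, h1, h2, h3, h4, h5, h6, h7⟩
    obtain ⟨g', t, htU, a1, a2, a3⟩ :=
      hE.exists_bump_step hΓ hP ht₀ φ ha hε h1 h2 h3 h4 h5 h6
    exact ⟨⟨(g', insert t S, U ∩ {t | ‖φ ((P g').1 t) - c‖ < ε / 2}), a1, a2, h3.insert t, a3,
      h5.inter (hopen g'), ⟨h6, a2⟩, fun t ht => ht.2⟩, t, htU, mem_insert t S,
      subset_insert t S, inter_subset_left⟩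
  choose next pt hpt hptS hS hU using step
  have h0 : ‖φ ((P f).1 t₀) - c‖ < ε / 2 := by rw [hc, sub_self, norm_zero]; exact hη
  let init : {s // Good s} := ⟨(f, ∅, {t | ‖φ ((P f).1 t) - c‖ < ε / 2}), hf, h0, finite_empty,
    by simp, hopen f, h0, fun t ht => ht⟩
  let s : ℕ → {s // Good s} := fun n => Nat.rec init (fun _ s => next s) n
  have hSmono : Monotone fun n => (s n).1.2.1 := monotone_nat_of_le_succ fun n => hS (s n)
  have hUanti : Antitone fun n => (s n).1.2.2 := antitone_nat_of_succ_le fun n => hU (s n)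
  let g : ℕ → E := fun n => (s n).1.1
  let τ : ℕ → K := fun n => pt (s n)
  -- The two index orders give incompatible estimates: τ n lies in every earlier U, while for i > n
  -- it lies in S of state i, where the negated conclusion `hno` applies to g i.
  have hnear : ∀ i n, i ≤ n → ‖φ ((P (g i)).1 (τ n)) - c‖ ≤ ε / 2 := fun i n hin =>
    ((s i).2.2.2.2.2.2.2 _ (hUanti hin (hpt (s n)))).le
  have hfar : ∀ i n, n < i → ε ≤ ‖φ ((P (g i)).1 (τ n)) - c‖ := fun i n hni =>
    hno _ _ (s i).2.1 ((s i).2.2.2.2.1 _ (hSmono (Nat.succ_le_of_lt hni) (hptS (s n))))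
  -- Along one ultrafilter, τ converges to t by compactness of K and P (g n) converges weakly to v
  -- by weak compactness. Both iterated limits of φ ((P (g i)).1 (τ n)) equal φ (v.1 t), which is
  -- impossible.
  let 𝒰 : Ultrafilter ℕ := hyperfilter ℕ
  have h𝒰 : (𝒰 : Filter ℕ) ≤ atTop := Nat.hyperfilter_le_atTop
  obtain ⟨t, -, ht⟩ := isCompact_univ.ultrafilter_le_nhds (𝒰.map τ) (by simp)
  have htend : Tendsto τ 𝒰 (𝓝 t) := ht
  obtain ⟨u, -, hu⟩ := IsCompact.ultrafilter_le_nhds hPw (𝒰.map fun n => toWeakSpace 𝕜 E (P (g n)))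
    (by
      rw [le_principal_iff]
      refine Ultrafilter.mem_coe.2 (Ultrafilter.mem_map.2 (univ_mem' fun n => subset_closure ?_))
      exact ⟨_, ⟨g n, by simpa using (s n).2.1.le, rfl⟩, rfl⟩)
  let v : E := (toWeakSpace 𝕜 E).symm u
  have hv : ∀ t, Tendsto (fun n => φ ((P (g n)).1 t)) 𝒰 (𝓝 (φ (v.1 t))) := fun t =>
    ((WeakBilin.eval_continuous (topDualPairing 𝕜 E).flip (pointFunctional E φ t)).tendsto
      u).comp hu
  have c1 : ‖φ (v.1 t) - c‖ ≤ ε / 2 := by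
    refine le_of_tendsto ((hv t).sub_const c).norm (Eventually.of_forall fun i => ?_)
    have hcont : Continuous fun t => ‖φ ((P (g i)).1 t) - c‖ := by fun_prop
    exact le_of_tendsto ((hcont.tendsto t).comp htend)
      (h𝒰 ((eventually_ge_atTop i).mono fun n hn => hnear i n hn))
  have c2 : ε ≤ ‖φ (v.1 t) - c‖ := by
    have hcont : Continuous fun t => ‖φ (v.1 t) - c‖ := by fun_prop
    refine ge_of_tendsto ((hcont.tendsto t).comp htend) (Eventually.of_forall fun n => ?_)
    exact ge_of_tendsto ((hv (τ n)).sub_const c).norm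
      (h𝒰 ((eventually_gt_atTop n).mono fun i hi => hfar i n hi))
  linarith

omit [CompactSpace K] [T2Space K] in
theorem IsAKXSpace.nontrivial (hE : IsAKXSpace E) : Nontrivial X := by
  obtain ⟨B, hB, -, -⟩ := hE.base_isUniformAlgebra
  obtain ⟨φ, f, -, hf⟩ : (1 : C(K, 𝕜)) ∈ baseAlgebra E := hB ▸ B.one_mem
  obtain ⟨t⟩ := ‹Nonempty K›
  refine ⟨⟨f t, 0, fun h => ?_⟩⟩
  simpa [h] using hf t

/-- The case v = 0 is allowed; an arbitrary nonzero vector then takes its place, which is why X must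
be nontrivial. -/
theorem exists_norming_pair (𝕜 : Type*) [RCLike 𝕜] {X : Type*} [NormedAddCommGroup X]
    [NormedSpace 𝕜 X] [Nontrivial X] (v : X) :
    ∃ (φ : StrongDual 𝕜 X) (e : X), ‖φ‖ = 1 ∧ ‖e‖ = 1 ∧ φ e = 1 ∧ φ v = ‖v‖ := by
  obtain ⟨w, hw, hv⟩ : ∃ w : X, w ≠ 0 ∧ (v = 0 ∨ v = w) := by
    by_cases hv : v = 0
    · obtain ⟨w, hw⟩ := exists_ne (0 : X)
      exact ⟨w, hw, Or.inl hv⟩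
    · exact ⟨v, hv, Or.inr rfl⟩
  have hw0 : ‖w‖ ≠ 0 := norm_ne_zero_iff.2 hw
  obtain ⟨φ, hφ, hφw⟩ := exists_dual_vector 𝕜 w hw0
  refine ⟨φ, ((‖w‖⁻¹ : ℝ) : 𝕜) • w, hφ, ?_, ?_, ?_⟩
  · rw [norm_smul, RCLike.norm_ofReal, abs_inv, abs_norm, inv_mul_cancel₀ hw0]
  · rw [map_smul, hφw, smul_eq_mul, ← RCLike.ofReal_mul, inv_mul_cancel₀ hw0, RCLike.ofReal_one]
  · rcases hv with rfl | rfl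
    · simp
    · exact hφw

/-- Let f almost norm P, and let φ norm (P f)(t₀), where t₀ in Γ norms P f.
`IsAKXSpace.exists_polynomial_near` gives g and t with φ(g(t)) ≈ 1 - ε and φ((P g)(t)) ≈ ‖P f‖, and
these two positive numbers add up. -/
theorem IsAKXSpace.hasPolynomialDaugavet (hE : IsAKXSpace E)
    (hΓ : ∀ t ∈ shilovBoundary (baseAlgebra E), AccPt t (𝓟 (shilovBoundary (baseAlgebra E)))) :
    HasPolynomialDaugavet 𝕜 E := by
  intro P hP hPw
  have hle : ∀ x : Metric.closedBall (0 : E) 1, ‖x.1 + P x‖ ≤ 1 + polyNorm P := fun x =>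
    (norm_add_le _ _).trans (add_le_add (mem_closedBall_zero_iff.1 x.2)
      (le_ciSup (hP.bddAbove 𝕜) x))
  have : Nonempty (Metric.closedBall (0 : E) 1) := ⟨⟨0, by simp⟩⟩
  refine le_antisymm (ciSup_le hle) (le_of_forall_pos_sub_le fun ε' hε' => ?_)
  -- Four losses of ε: one from f, one from the norm 1 - ε of the target value, two from the
  -- approximations at t.
  obtain ⟨ε, hε, hε1, hεε'⟩ : ∃ ε > 0, ε ≤ 1 ∧ 4 * ε ≤ ε' :=
    ⟨min 1 (ε' / 4), by positivity, min_le_left _ _, by linarith [min_le_right 1 (ε' / 4)]⟩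
  obtain ⟨f, hf, hPf⟩ : ∃ f : E, ‖f‖ < 1 ∧ polyNorm P - ε < ‖P f‖ := by
    obtain ⟨⟨f, hf⟩, hPf⟩ := exists_lt_of_lt_ciSup
      (show polyNorm P - ε < ⨆ x : Metric.closedBall (0 : E) 1, ‖P x‖ from sub_lt_self _ hε)
    -- Perturbations need room inside the ball, so f is shrunk to r f with r < 1 close to 1.
    have hf1 : ‖f‖ ≤ 1 := by simpa using hf
    have hcont : Continuous fun r : ℝ => ‖P ((r : 𝕜) • f)‖ := by
      have := hP.continuous
      fun_prop
    have hlim : ∀ᶠ r : ℝ in 𝓝[<] (1 : ℝ), polyNorm P - ε < ‖P ((r : 𝕜) • f)‖ :=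
      nhdsWithin_le_nhds (((hcont.tendsto 1).eventually
        (lt_mem_nhds (show polyNorm P - ε < ‖P (((1 : ℝ) : 𝕜) • f)‖ by simpa using hPf))))
    obtain ⟨r, hr, hr1, hr0⟩ := (hlim.and ((eventually_mem_nhdsWithin).and
      (nhdsWithin_le_nhds (lt_mem_nhds (one_pos (α := ℝ)))))).exists
    refine ⟨(r : 𝕜) • f, ?_, hr⟩
    have hr0 : 0 < r := hr0
    have hr1 : r < 1 := hr1
    rw [norm_smul, RCLike.norm_ofReal, abs_of_pos hr0]
    nlinarith [norm_nonneg f]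
  obtain ⟨t₀, ht₀, hPt₀⟩ := hE.exists_mem_norm_eq (P f)
  have := hE.nontrivial
  obtain ⟨φ, e, hφ, he, hφe, hφP⟩ := exists_norming_pair 𝕜 ((P f).1 t₀)
  have ha : ‖((1 - ε : ℝ) : 𝕜) • e‖ < 1 := by
    rw [norm_smul, he, RCLike.norm_ofReal, abs_of_nonneg (by linarith)]
    linarith
  obtain ⟨g, t, hg, h1, h2⟩ := hE.exists_polynomial_near hΓ hP hPw hf ht₀ φ ha hε
  rw [map_smul, hφe, smul_eq_mul, mul_one] at h1
  rw [hφP, hPt₀] at h2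
  have h3 : ‖φ ((g + P g).1 t)‖ ≤ ‖g + P g‖ :=
    (φ.le_of_opNorm_le hφ.le _).trans (by
      rw [one_mul]; exact (g + P g).1.norm_coe_le_norm t)
  have h4 : φ ((g + P g).1 t) = ((1 - ε + ‖P f‖ : ℝ) : 𝕜) + ((φ (g.1 t) - ((1 - ε : ℝ) : 𝕜)) +
      (φ ((P g).1 t) - (‖P f‖ : 𝕜))) := by
    change φ (g.1 t + (P g).1 t) = _
    rw [map_add]
    push_cast
    ring
  have h5 : 1 - ε + ‖P f‖ ≤ ‖φ ((g + P g).1 t)‖ + 2 * ε := by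
    have hn : ‖((1 - ε + ‖P f‖ : ℝ) : 𝕜)‖ = 1 - ε + ‖P f‖ := by
      rw [RCLike.norm_ofReal, abs_of_nonneg (by linarith [norm_nonneg (P f)])]
    rw [← hn, eq_sub_of_add_eq h4.symm]
    refine (norm_sub_le _ _).trans ?_
    gcongr
    exact (norm_add_le _ _).trans (by linarith)
  have h6 : ‖g + P g‖ ≤ polyNorm fun x => x + P x :=
    le_ciSup (f := fun x : Metric.closedBall (0 : E) 1 => ‖x.1 + P x‖)
      ⟨_, by rintro _ ⟨x, rfl⟩; exact hle x⟩ ⟨g, by simpa using hg.le⟩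
  linarith

end PolynomialDaugavet

/-! ### Rank-one projections and property (D) -/

section RankOneProjections

variable {𝕜 : Type*} [RCLike 𝕜] {Y : Type*} [NormedAddCommGroup Y] [NormedSpace 𝕜 Y]

theorem exists_eq_smul_of_finrank_range_eq_one {P : Y →L[𝕜] Y} (hP : IsIdempotentElem P)
    (hrank : Module.finrank 𝕜 (LinearMap.range (P : Y →ₗ[𝕜] Y)) = 1) (hnorm : ‖P‖ = 1) :
    ∃ (φ : StrongDual 𝕜 Y) (y : Y), ‖φ‖ = 1 ∧ ‖y‖ = 1 ∧ φ y = 1 ∧ ∀ z, P z = φ z • y := by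
  obtain ⟨⟨v, w, rfl⟩, hv0, hv⟩ := finrank_eq_one_iff'.1 hrank
  have hv0' : ‖P w‖ ≠ 0 := norm_ne_zero_iff.2 fun h => hv0 (Subtype.ext h)
  obtain ⟨ψ, hψ, hψv⟩ := exists_dual_vector 𝕜 (P w) hv0'
  set r : 𝕜 := ((‖P w‖⁻¹ : ℝ) : 𝕜) with hr
  have hrv : r * (‖P w‖ : 𝕜) = 1 := by
    rw [hr, ← RCLike.ofReal_mul, inv_mul_cancel₀ hv0', RCLike.ofReal_one]
  have hPP : P (P w) = P w := DFunLike.congr_fun hP.eq w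
  have hφy : (ψ ∘L P) (r • P w) = 1 := by
    rw [ContinuousLinearMap.comp_apply, map_smul, map_smul, hPP, hψv, smul_eq_mul, hrv]
  have hy : ‖r • P w‖ = 1 := by
    rw [norm_smul, hr, RCLike.norm_ofReal, abs_inv, abs_norm, inv_mul_cancel₀ hv0']
  refine ⟨ψ ∘L P, r • P w, le_antisymm ?_ ?_, hy, hφy, fun z => ?_⟩
  · exact (ψ.opNorm_comp_le P).trans (by rw [hψ, hnorm, mul_one])
  · have := (ψ ∘L P).le_opNorm (r • P w)
    rwa [hφy, hy, mul_one, norm_one] at this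
  · obtain ⟨c, hc⟩ := hv ⟨P z, z, rfl⟩
    have hc' : P z = c • P w := (congrArg Subtype.val hc).symm
    rw [ContinuousLinearMap.comp_apply, hc', map_smul, hψv, smul_smul, smul_eq_mul, mul_assoc,
      mul_comm _ r, hrv, mul_one]

theorem isIdempotentElem_smulRight {φ : StrongDual 𝕜 Y} {y : Y} (h : φ y = 1) :
    IsIdempotentElem (φ.smulRight y) := by
  ext1 z
  change φ (φ z • y) • y = φ z • y
  rw [map_smul, h, smul_eq_mul, mul_one]

theorem finrank_range_smulRight {φ : StrongDual 𝕜 Y} {y : Y} (h : φ y = 1) :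
    Module.finrank 𝕜 (LinearMap.range (φ.smulRight y : Y →ₗ[𝕜] Y)) = 1 := by
  have hy : φ y • y = y := by rw [h, one_smul]
  have hy0 : y ≠ 0 := fun h0 => by rw [h0, map_zero] at h; exact zero_ne_one h
  refine finrank_eq_one_iff'.2 ⟨⟨y, y, hy⟩, fun h => hy0 (congrArg Subtype.val h), ?_⟩
  rintro ⟨_, z, rfl⟩
  exact ⟨φ z, rfl⟩

theorem norm_id_sub_le_two {P : Y →L[𝕜] Y} (hnorm : ‖P‖ = 1) :
    ‖ContinuousLinearMap.id 𝕜 Y - P‖ ≤ 2 :=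
  (norm_sub_le _ _).trans (by linarith [ContinuousLinearMap.norm_id_le (𝕜 := 𝕜) (E := Y)])

/-- Write P z = φ(z) y. In a thin slice given by φ, P z is close to y, so a point z of the slice
almost at distance 2 from y is almost at distance 2 from P z. -/
theorem HasDLD2P.hasPropertyD (h : HasDLD2P 𝕜 Y) : HasPropertyD 𝕜 Y := by
  intro P hP hrank hnorm
  obtain ⟨φ, y, hφ, hy, hφy, hPz⟩ := exists_eq_smul_of_finrank_range_eq_one hP hrank hnorm
  refine le_antisymm (norm_id_sub_le_two hnorm) (le_of_forall_pos_sub_le fun ε hε => ?_)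
  set η := min (ε / 2) (ε ^ 2 / 8) with hη
  have hη0 : 0 < η := by positivity
  have hre : ∀ z : Y, ‖z‖ ≤ 1 → ‖φ z‖ ≤ 1 := fun z hz =>
    (φ.le_of_opNorm_le hφ.le z).trans (by linarith)
  have hsup : sSup ((fun y => RCLike.re (φ y)) '' Metric.closedBall (0 : Y) 1) = 1 := by
    refine IsGreatest.csSup_eq ⟨⟨y, by simp [hy], by simp [hφy]⟩, ?_⟩
    rintro _ ⟨z, hz, rfl⟩
    exact (RCLike.re_le_norm _).trans (hre z (by simpa using hz))
  have hlub := h (slice 𝕜 (Metric.closedBall (0 : Y) 1) φ η) ⟨φ, hφ, η, hη0, rfl⟩ y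
    ⟨⟨by simp [hy], by simp [hsup, hφy, hη0]⟩, by simp [hy]⟩
  obtain ⟨_, ⟨z, ⟨hzB, hzS⟩, rfl⟩, hlt, -⟩ := hlub.exists_between (sub_lt_self 2 (half_pos hε))
  have hlt : 2 - ε / 2 < ‖y - z‖ := hlt
  rw [hsup] at hzS
  have hz : ‖z‖ ≤ 1 := by simpa using hzB
  have h1 : ‖1 - φ z‖ ≤ ε / 2 := by
    -- As |φ z| ≤ 1 and Re φ z > 1 - η, |1 - φ z|² ≤ 2 - 2 Re φ z < 2η ≤ ε² / 4.
    refine le_of_sq_le_sq ?_ (by positivity)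
    have h2 : ‖1 - φ z‖ ^ 2 = 1 - 2 * RCLike.re (φ z) + ‖φ z‖ ^ 2 := by
      rw [← RCLike.normSq_eq_def', ← RCLike.normSq_eq_def', RCLike.normSq_apply,
        RCLike.normSq_apply]
      simp only [map_sub, RCLike.one_re, RCLike.one_im]
      ring
    have h3 : ‖φ z‖ ^ 2 ≤ 1 := pow_le_one₀ (norm_nonneg _) (hre z hz)
    have h4 : η ≤ ε ^ 2 / 8 := min_le_right _ _
    rw [h2]
    linarith
  have h2 : ‖(ContinuousLinearMap.id 𝕜 Y - P) z‖ ≤ ‖ContinuousLinearMap.id 𝕜 Y - P‖ :=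
    ContinuousLinearMap.unit_le_opNorm _ z hz
  have h3 : y - z = (1 - φ z) • y - (ContinuousLinearMap.id 𝕜 Y - P) z := by
    rw [_root_.sub_apply, ContinuousLinearMap.id_apply, hPz]
    module
  have h4 : ‖y - z‖ ≤ ‖1 - φ z‖ + ‖(ContinuousLinearMap.id 𝕜 Y - P) z‖ := by
    rw [h3]
    refine (norm_sub_le _ _).trans ?_
    rw [norm_smul, hy, mul_one]
  linarith

theorem HasPolynomialDaugavet.hasPropertyD (h : HasPolynomialDaugavet 𝕜 Y) :
    HasPropertyD 𝕜 Y := by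
  intro P hP hrank hnorm
  obtain ⟨φ, y, hφ, hy, hφy, hPz⟩ := exists_eq_smul_of_finrank_range_eq_one hP hrank hnorm
  have hpoly : IsContinuousPolynomial 𝕜 fun z => (-P) z :=
    ⟨(-P).fpowerSeries 0, 2, fun x => by simp [Finset.sum_range_succ]⟩
  have hcomp : IsWeaklyCompactMap 𝕜 fun z => (-P) z := by
    have hc : IsCompact (toWeakSpaceCLM 𝕜 Y '' ((fun c : 𝕜 => c • y) '' Metric.closedBall 0 1)) :=
      ((isCompact_closedBall (0 : 𝕜) 1).image (by fun_prop)).image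
        (toWeakSpaceCLM 𝕜 Y).continuous
    refine hc.closure_of_subset ?_
    rintro _ ⟨_, ⟨z, hz, rfl⟩, rfl⟩
    refine ⟨_, ⟨-φ z, ?_, rfl⟩, ?_⟩
    · have hz : ‖z‖ ≤ 1 := by simpa using hz
      simpa using (φ.le_of_opNorm_le hφ.le z).trans (by linarith)
    · simp [hPz, toWeakSpaceCLM_eq_toWeakSpace]
  have hN : 1 ≤ polyNorm fun z => (-P) z := by
    refine le_trans ?_ (le_ciSup (hpoly.bddAbove 𝕜) ⟨y, by simp [hy]⟩)
    simp [hPz, hφy, hy]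
  have hD := h _ hpoly hcomp
  have hle : (polyNorm fun z => z + (-P) z) ≤ ‖ContinuousLinearMap.id 𝕜 Y - P‖ := by
    have : Nonempty (Metric.closedBall (0 : Y) 1) := ⟨⟨0, by simp⟩⟩
    refine ciSup_le fun z => ?_
    have := ContinuousLinearMap.unit_le_opNorm (ContinuousLinearMap.id 𝕜 Y - P) z.1
      (mem_closedBall_zero_iff.1 z.2)
    simpa [sub_eq_add_neg] using this
  exact le_antisymm (norm_id_sub_le_two hnorm) (by linarith)

/-- In a LUR space, `‖u - φ(u) x‖` stays away from `2` for normalized `φ, x` with `φ x = 1`. -/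
theorem IsLUR.exists_norm_sub_smul_le (hY : IsLUR 𝕜 Y) {φ : StrongDual 𝕜 Y} {x : Y}
    (hφ : ‖φ‖ = 1) (hx : ‖x‖ = 1) (hφx : φ x = 1) :
    ∃ r < 2, ∀ u, ‖u - φ u • x‖ ≤ r * ‖u‖ := by
  suffices ∃ r < 2, ∀ u, ‖u‖ ≤ 1 → ‖u - φ u • x‖ ≤ r by
    obtain ⟨r, hr2, hr⟩ := this
    refine ⟨r, hr2, fun u => ?_⟩
    by_cases hu : u = 0
    · simp [hu]
    · have hu0 : 0 < ‖u‖ := norm_pos_iff.2 hu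
      have hn : ‖((‖u‖⁻¹ : ℝ) : 𝕜)‖ = ‖u‖⁻¹ := by
        rw [RCLike.norm_ofReal, abs_inv, abs_norm]
      have h1 := hr (((‖u‖⁻¹ : ℝ) : 𝕜) • u) (by rw [norm_smul, hn, inv_mul_cancel₀ hu0.ne'])
      rwa [map_smul, smul_assoc, ← smul_sub, norm_smul, hn, inv_mul_le_iff₀ hu0, mul_comm] at h1
  by_contra! hno
  have hpos : ∀ n : ℕ, (0 : ℝ) < 1 / (n + 1) := fun n => Nat.one_div_pos_of_nat
  choose u hu1 hu using fun n : ℕ => hno (2 - 1 / (n + 1)) (sub_lt_self _ (hpos n))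
  -- Rotating u n to v n makes φ (v n) = |φ (u n)| nonnegative without changing norms.
  have hdec : ∀ n, ∃ θ : 𝕜, ‖θ‖ = 1 ∧ θ * φ (u n) = ‖φ (u n)‖ := fun n =>
    RCLike.exists_norm_eq_mul_self (φ (u n)) |>.imp fun θ h => ⟨h.1, h.2.symm⟩
  choose θ hθ hθφ using hdec
  let v : ℕ → Y := fun n => θ n • u n
  have hv1 : ∀ n, ‖v n‖ ≤ 1 := fun n => by
    simp only [v, norm_smul, hθ, one_mul, hu1]
  have hφv : ∀ n, φ (v n) = ‖φ (u n)‖ := fun n => by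
    simp only [v, map_smul, smul_eq_mul, hθφ]
  have hvx : ∀ n : ℕ, 2 - 1 / ((n : ℝ) + 1) < ‖v n - (‖φ (u n)‖ : 𝕜) • x‖ := fun n => by
    have : v n - (‖φ (u n)‖ : 𝕜) • x = θ n • (u n - φ (u n) • x) := by
      rw [← hθφ, smul_sub, smul_smul]
    rw [this, norm_smul, hθ, one_mul]
    exact hu n
  have hφu1 : ∀ n, ‖φ (u n)‖ ≤ 1 := fun n =>
    (φ.le_of_opNorm_le hφ.le _).trans (by linarith [hu1 n])
  have hsub : ∀ n, ‖v n - (‖φ (u n)‖ : 𝕜) • x‖ ≤ ‖v n‖ + ‖φ (u n)‖ := fun n =>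
    (norm_sub_le _ _).trans_eq (by rw [norm_smul _ x, hx, RCLike.norm_ofReal, abs_norm, mul_one])
  have hlim : Tendsto (fun n : ℕ => 1 - 1 / ((n : ℝ) + 1)) atTop (𝓝 1) := by
    simpa using tendsto_const_nhds.sub (tendsto_one_div_add_atTop_nhds_zero_nat (𝕜 := ℝ))
  -- Norms almost 2 of v n - |φ (u n)| x force both ‖v n‖ and |φ (u n)| to tend to 1. Testing v n +
  -- x against φ then gives `l2`, so LUR yields v n → x. But then v n - |φ (u n)| x → 0, a
  -- contradiction.
  have l1 : Tendsto (fun n => ‖v n‖) atTop (𝓝 ‖x‖) := by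
    rw [hx]
    exact tendsto_of_tendsto_of_tendsto_of_le_of_le hlim tendsto_const_nhds
      (fun n => by linarith [hvx n, hsub n, hφu1 n]) hv1
  have l2 : Tendsto (fun n => ‖(2⁻¹ : 𝕜) • (v n + x)‖) atTop (𝓝 ‖x‖) := by
    rw [hx]
    have h2 : ‖(2⁻¹ : 𝕜)‖ = 2⁻¹ := by rw [norm_inv, RCLike.norm_ofNat]
    refine tendsto_of_tendsto_of_tendsto_of_le_of_le hlim tendsto_const_nhds (fun n => ?_)
      (fun n => ?_)
    · have h3 := φ.le_of_opNorm_le hφ.le (v n + x)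
      rw [map_add, hφv, hφx, one_mul] at h3
      have h4 : ‖(‖φ (u n)‖ : 𝕜) + 1‖ = ‖φ (u n)‖ + 1 := by
        rw [← RCLike.ofReal_one, ← RCLike.ofReal_add, RCLike.norm_ofReal, abs_of_nonneg
          (by positivity)]
      rw [h4] at h3
      simp only [norm_smul, h2]
      linarith [hvx n, hsub n, hv1 n, hpos n]
    · simp only [norm_smul, h2]
      linarith [norm_add_le (v n) x, hv1 n]
  have l3 := hY x v l2 l1
  obtain ⟨n, hn1, hn2⟩ := ((l3.eventually (gt_mem_nhds (show (0 : ℝ) < 1 / 2 by norm_num))).and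
    (hlim.eventually (lt_mem_nhds (show (3 / 4 : ℝ) < 1 by norm_num)))).exists
  have h5 : ‖v n - (‖φ (u n)‖ : 𝕜) • x‖ ≤ ‖v n - x‖ + (1 - ‖φ (u n)‖) := by
    have : v n - (‖φ (u n)‖ : 𝕜) • x = (v n - x) + ((1 - ‖φ (u n)‖ : ℝ) : 𝕜) • x := by
      push_cast; module
    rw [this]
    refine (norm_add_le _ _).trans_eq ?_
    rw [norm_smul, hx, RCLike.norm_ofReal, abs_of_nonneg (by linarith [hφu1 n]), mul_one]
  linarith [hvx n, norm_nonneg (φ (u n))]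

end RankOneProjections

/-! ### Isolated points of the Shilov boundary -/

section IsolatedPoints

variable {𝕜 : Type*} [RCLike 𝕜] {K : Type*} [TopologicalSpace K] [CompactSpace K] [Nonempty K]
  {X : Type*} [NormedAddCommGroup X] [NormedSpace 𝕜 X] {E : Submodule 𝕜 C(K, X)}

/-- The indicator of an isolated point of the Shilov boundary belongs to the base algebra. -/
theorem IsAKXSpace.exists_indicator (hE : IsAKXSpace E) {t₀ : K}
    (ht₀ : t₀ ∈ shilovBoundary (baseAlgebra E))
    (hiso : ¬ AccPt t₀ (𝓟 (shilovBoundary (baseAlgebra E)))) :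
    ∃ e ∈ baseAlgebra E, e t₀ = 1 ∧ ∀ s ∈ shilovBoundary (baseAlgebra E), s ≠ t₀ → e s = 0 := by
  obtain ⟨B, hB, hcl, hsep⟩ := hE.base_isUniformAlgebra
  have hbd := hE.isBoundary
  set Γ := shilovBoundary (baseAlgebra E) with hΓ
  rw [accPt_iff_nhds] at hiso
  push Not at hiso
  obtain ⟨V, hV, hVΓ⟩ := hiso
  obtain ⟨U, hUV, hU, ht₀U⟩ := mem_nhds_iff.1 hV
  have hpeak := exists_peak B hsep hU (by rw [hB]; exact ⟨t₀, ht₀U, ht₀⟩)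
    (ε := 1 / 2) (by norm_num)
  rw [hB, ← hΓ] at hpeak
  obtain ⟨f, hfB, t, ht, hft, hf1, hf2⟩ := hpeak
  obtain rfl : t = t₀ := hVΓ t ⟨hUV ht.1, ht.2⟩
  have hsmall : ∀ s ∈ Γ, s ≠ t → ‖f s‖ ≤ 1 / 2 := fun s hs hst =>
    hf2 s ⟨hs, fun hsU => hst (hVΓ s ⟨hUV hsU, hs⟩)⟩
  have hmem : ∀ n, f ^ n ∈ baseAlgebra E := fun n => hB ▸ pow_mem hfB n
  -- Norms in the base algebra are computed on Γ, where f is 1 at t and at most 1 / 2 in modulus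
  -- elsewhere. The powers of f therefore converge uniformly on K, and the limit is the indicator of
  -- t on Γ.
  have hcauchy : CauchySeq fun n => f ^ n := by
    refine cauchySeq_of_le_geometric (1 / 2) 2 (by norm_num) fun n => ?_
    obtain ⟨s, hs, hn⟩ := hbd (f ^ n - f ^ (n + 1)) (hB ▸ B.sub_mem (pow_mem hfB _) (pow_mem hfB _))
    rw [dist_eq_norm, ← hn]
    have hval : (f ^ n - f ^ (n + 1)) s = f s ^ n * (1 - f s) := by
      simp [pow_succ]; ring
    rw [hval, norm_mul, norm_pow]
    by_cases hst : s = t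
    · rw [hst, hft]; simp
    · have h1 := hsmall s hs hst
      have h2 : ‖1 - f s‖ ≤ 2 := (norm_sub_le _ _).trans (by rw [norm_one]; linarith)
      calc ‖f s‖ ^ n * ‖1 - f s‖ ≤ (1 / 2) ^ n * 2 := by gcongr
        _ = 2 * (1 / 2) ^ n := mul_comm _ _
  obtain ⟨e, he⟩ := cauchySeq_tendsto_of_complete hcauchy
  have hev : ∀ s, Tendsto (fun n => f s ^ n) atTop (𝓝 (e s)) := fun s =>
    ((show Continuous fun f : C(K, 𝕜) => f s by fun_prop).tendsto e).comp he
  refine ⟨e, hcl.mem_of_tendsto he (Eventually.of_forall hmem), ?_, fun s hs hst => ?_⟩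
  · refine tendsto_nhds_unique (hev t) ?_
    simp [hft]
  · exact tendsto_nhds_unique (hev s) (tendsto_pow_atTop_nhds_zero_of_norm_lt_one
      ((hsmall s hs hst).trans_lt (by norm_num)))

/-- For P g = φ(g(t₀)) e x, the function g - P g agrees with g on Γ away from t₀, while at t₀ its
norm is at most r ‖g(t₀)‖ with r < 2 by LUR. Thus ‖I - P‖ ≤ max 1 r < 2. -/
theorem IsAKXSpace.accPt_of_hasPropertyD (hE : IsAKXSpace E) (hX : IsLUR 𝕜 X)
    (hD : HasPropertyD 𝕜 E) {t₀ : K} (ht₀ : t₀ ∈ shilovBoundary (baseAlgebra E)) :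
    AccPt t₀ (𝓟 (shilovBoundary (baseAlgebra E))) := by
  by_contra hiso
  obtain ⟨e, he, het₀, he0⟩ := hE.exists_indicator ht₀ hiso
  have := hE.nontrivial
  obtain ⟨φ, x, hφ, hx, hφx, -⟩ := exists_norming_pair 𝕜 (0 : X)
  let y : E := ⟨e • ContinuousMap.const K x, hE.tensor_mem e he x⟩
  have hyval : ∀ s, y.1 s = e s • x := fun s => rfl
  have hy1 : ‖y‖ ≤ 1 := hE.norm_le y fun s hs => by
    rw [hyval, norm_smul, hx, mul_one]
    by_cases hst : s = t₀
    · rw [hst, het₀, norm_one]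
    · rw [he0 s hs hst, norm_zero]; exact zero_le_one
  let ψ : StrongDual 𝕜 E := pointFunctional E φ t₀
  have hψval : ∀ g, ψ g = φ (g.1 t₀) := fun g => rfl
  have hψy : ψ y = 1 := by rw [hψval, hyval, het₀, one_smul, hφx]
  have hy0 : y ≠ 0 := fun h => by rw [h, map_zero] at hψy; exact zero_ne_one hψy
  let P : E →L[𝕜] E := ψ.smulRight y
  have hPval : ∀ g, P g = ψ g • y := fun g => rfl
  have hidem : IsIdempotentElem P := isIdempotentElem_smulRight hψy
  have hrank := finrank_range_smulRight hψy
  have hψle : ∀ g, ‖ψ g‖ ≤ ‖g‖ := fun g =>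
    (φ.le_of_opNorm_le hφ.le _).trans (by rw [one_mul]; exact g.1.norm_coe_le_norm t₀)
  have hnorm : ‖P‖ = 1 := by
    refine le_antisymm (P.opNorm_le_bound zero_le_one fun g => ?_) ?_
    · rw [hPval, norm_smul, one_mul]
      exact (mul_le_of_le_one_right (norm_nonneg _) hy1).trans (hψle g)
    · have h1 := P.le_opNorm y
      rw [hPval, hψy, one_smul] at h1
      exact le_of_mul_le_mul_right (by rwa [one_mul]) (norm_pos_iff.2 hy0)
  obtain ⟨r, hr2, hr⟩ := hX.exists_norm_sub_smul_le hφ hx hφx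
  have hle : ‖ContinuousLinearMap.id 𝕜 E - P‖ ≤ max 1 r := by
    refine ContinuousLinearMap.opNorm_le_bound _ (zero_le_one.trans (le_max_left _ _)) fun g => ?_
    refine hE.norm_le _ fun s hs => ?_
    have hval : ((ContinuousLinearMap.id 𝕜 E - P) g).1 s = g.1 s - φ (g.1 t₀) • e s • x := rfl
    have hgs : ‖g.1 s‖ ≤ ‖g‖ := g.1.norm_coe_le_norm s
    rw [hval]
    by_cases hst : s = t₀
    · subst hst
      rw [het₀, one_smul]
      calc ‖g.1 s - φ (g.1 s) • x‖ ≤ r * ‖g.1 s‖ := hr _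
        _ ≤ max 1 r * ‖g‖ := by gcongr; exact le_max_right _ _
    · rw [he0 s hs hst, zero_smul, smul_zero, sub_zero]
      exact hgs.trans (le_mul_of_one_le_left (norm_nonneg _) (le_max_left _ _))
  rw [hD P hidem hrank hnorm] at hle
  exact absurd hle (not_le.2 (max_lt one_lt_two hr2))

end IsolatedPoints

theorem mainTheorem7 {𝕜 : Type*} [RCLike 𝕜]
    {K : Type*} [TopologicalSpace K] [CompactSpace K] [T2Space K] [Nonempty K]
    {X : Type*} [NormedAddCommGroup X] [NormedSpace 𝕜 X] [CompleteSpace X]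
    (hX : IsLUR 𝕜 X)
    (E : Submodule 𝕜 C(K, X)) (hE : IsAKXSpace E) :
    List.TFAE [
      -- the Shilov boundary of the base algebra has no isolated points
      ∀ t ∈ shilovBoundary (baseAlgebra E), AccPt t (𝓟 (shilovBoundary (baseAlgebra E))),
      HasPolynomialDaugavet 𝕜 E,
      HasRestrictedDSD2P 𝕜 E,
      HasDD2P 𝕜 E,
      HasDLD2P 𝕜 E,
      HasPropertyD 𝕜 E] := by
  tfae_have 1 → 2 := hE.hasPolynomialDaugavet
  tfae_have 1 → 3 := hE.hasRestrictedDSD2P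
  tfae_have 1 → 4 := hE.hasDD2P
  tfae_have 3 → 5 := HasRestrictedDSD2P.hasDLD2P
  tfae_have 4 → 5 := HasDD2P.hasDLD2P
  tfae_have 2 → 6 := HasPolynomialDaugavet.hasPropertyD
  tfae_have 5 → 6 := HasDLD2P.hasPropertyD
  tfae_have 6 → 1 := fun h t ht => hE.accPt_of_hasPropertyD hX h ht
  tfae_finish
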